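/- Let $n\ge 1$ and let $P_n=\mathbb{Q}[x_1,\dots,x_n]\otimes\bigwedge[\omega_1,\dots,\omega_n]$ be the ring of extended polynomials. Let $s_1,\dots,s_n$ be the $\mathbb{Q}$-algebra automorphisms of $P_n$ such that, for $i<n$, $s_i$ exchanges $x_i$ and $x_{i+1}$, fixes the other $x_j$, and satisfies $s_i(\omega_j)=\omega_j+\delta_{ij}(x_i^2-x_{i+1}^2)\omega_{i+1}$, while $s_n(x_n)=-x_n$, $s_n(x_j)=x_j$ for $j<n$, and $s_n(\omega_j)=\omega_j$ for all $j$. Let $\partial_i=\frac{\mathrm{id}-s_i}{x_i-s_i(x_i)}$ $(1\le i\le n)$ be the Demazure operators on $P_n$. The type B extended nilHecke algebra ${}^{\mathfrak b}\mathsf{NH}_n^{ext}$ is the subalgebra of $\operatorname{End}_{\mathbb{Q}}(P_n)$ generated by the multiplications by elements of $P_n$ and by $\partial_1,\dots,\partial_n$; it is a superalgebra with generators $\omega_i$ odd and $x_i,\partial_i$ even. The type B nilHecke algebra ${}^{\mathfrak b}\mathsf{NH}_n$ is the $\mathbb{Q}$-algebra with generators $x_1,\dots,x_n,\partial_1,\dots,\partial_n$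 and relations $x_ix_j=x_jx_i$; $\partial_i^2=0$; $\partial_i\partial_j=\partial_j\partial_i$ if $|i-j|>1$; $\partial_i\partial_{i+1}\partial_i=\partial_{i+1}\partial_i\partial_{i+1}$ for $1\le i<n-1$; $\partial_{n-1}\partial_n\partial_{n-1}\partial_n=\partial_n\partial_{n-1}\partial_n\partial_{n-1}$ if $n\ge 2$; $\partial_ix_j=x_j\partial_i$ if $j\ne i,i+1$; $\partial_ix_i-x_{i+1}\partial_i=1$ and $\partial_ix_{i+1}-x_i\partial_i=-1$ for $1\le i<n$; and $\partial_nx_n+x_n\partial_n=1$. Let ${}^{\mathfrak b}\mathsf{NH}_n\rtimes\bigwedge[\omega_1,\dots,\omega_n]$ be the algebra generated by $x_i,\partial_i,\omega_i$ $(1\le i\le n)$ subject to the relations of ${}^{\mathfrak b}\mathsf{NH}_n$, the exterior relations $\omega_i\omega_j=-\omega_j\omega_i$, $\omega_i^2=0$, and the mixed relations $$x_i\omega_j=\omega_jx_i\ \text{ for all } i,j,\qquad \partial_i\omega_j=\omega_j\partial_i\ \text{ for } i\ne j,$$ $$\partial_i(\omega_i-x_{i+1}^2\omega_{i+1})=(\omega_i-x_{i+1}^2\omega_{i+1})\partial_i\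 \text{ for } i<n,\qquad \partial_n\omega_i=\omega_i\partial_n\ \text{ for } 1\le i\le n,$$ with the $\omega_i$ odd and the $x_i,\partial_i$ even. Then both algebras are superalgebras (the stated parities define $\mathbb{Z}/2$-gradings); multiplication $h\otimes\lambda\mapsto h\lambda$ is an isomorphism of vector spaces from ${}^{\mathfrak b}\mathsf{NH}_n\otimes\bigwedge[\omega_1,\dots,\omega_n]$ to ${}^{\mathfrak b}\mathsf{NH}_n\rtimes\bigwedge[\omega_1,\dots,\omega_n]$; and there is an isomorphism of $\mathbb{Q}$-superalgebras $${}^{\mathfrak b}\mathsf{NH}_n\rtimes\bigwedge[\omega_1,\dots,\omega_n]\;\cong\;{}^{\mathfrak b}\mathsf{NH}_n^{ext}$$ sending each generator $x_i,\partial_i,\omega_i$ to the corresponding operator on $P_n$ (multiplication by $x_i$, the Demazure operator $\partial_i$, multiplication by $\omega_i$). -/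

import Mathlib

open scoped TensorProduct

namespace ExtNilHecke

/-! ### Extended polynomials -/

/-- The exterior algebra `⋀[ω_1, …, ω_n]` over `ℚ`. -/
abbrev Ext (n : ℕ) : Type := ExteriorAlgebra ℚ (Fin n → ℚ)

/-- The extended polynomial ring `ℚ[x_1, …, x_n] ⊗ ⋀[ω_1, …, ω_n]`.
Indices run over `Fin n`, so the index `i` of the usual notation is `i - 1` here; the last index
`i` is the one with `i + 1 = n`. -/
def Poly (n : ℕ) : Type := MvPolynomial (Fin n) ℚ ⊗[ℚ] Ext n

noncomputable instance instRingPoly (n : ℕ) : Ring (Poly n) :=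
  inferInstanceAs (Ring (MvPolynomial (Fin n) ℚ ⊗[ℚ] Ext n))

noncomputable instance instAlgebraPoly (n : ℕ) : Algebra ℚ (Poly n) :=
  inferInstanceAs (Algebra ℚ (MvPolynomial (Fin n) ℚ ⊗[ℚ] Ext n))

/-- The inclusion `p ↦ p ⊗ 1` of the polynomials into the extended polynomials. -/
noncomputable def ofPoly {n : ℕ} : MvPolynomial (Fin n) ℚ →ₐ[ℚ] Poly n :=
  (Algebra.TensorProduct.includeLeft :
    MvPolynomial (Fin n) ℚ →ₐ[ℚ] MvPolynomial (Fin n) ℚ ⊗[ℚ] Ext n)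

/-- The inclusion `w ↦ 1 ⊗ w` of the exterior algebra into the extended polynomials. -/
noncomputable def ofExt {n : ℕ} : Ext n →ₐ[ℚ] Poly n :=
  (Algebra.TensorProduct.includeRight : Ext n →ₐ[ℚ] MvPolynomial (Fin n) ℚ ⊗[ℚ] Ext n)

theorem ofPoly_comm_ofExt {n : ℕ} (p : MvPolynomial (Fin n) ℚ) (w : Ext n) :
    Commute (ofPoly p) (ofExt w) := by
  have e : (p ⊗ₜ[ℚ] (1 : Ext n)) * ((1 : MvPolynomial (Fin n) ℚ) ⊗ₜ[ℚ] w)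
      = ((1 : MvPolynomial (Fin n) ℚ) ⊗ₜ[ℚ] w) * (p ⊗ₜ[ℚ] (1 : Ext n)) := by
    simp only [Algebra.TensorProduct.tmul_mul_tmul, mul_one, one_mul]
  exact e

theorem poly_induction {n : ℕ} {C : Poly n → Prop} (f : Poly n)
    (h : ∀ p w, C (ofPoly p * ofExt w)) (hadd : ∀ a b, C a → C b → C (a + b)) : C f := by
  have h0 : C 0 := by simpa using h 0 0
  refine TensorProduct.induction_on (motive := C) f h0 (fun p w => ?_) hadd
  have e : (p ⊗ₜ[ℚ] w : MvPolynomial (Fin n) ℚ ⊗[ℚ] Ext n) = (p ⊗ₜ[ℚ] 1) * (1 ⊗ₜ[ℚ] w) := by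
    rw [Algebra.TensorProduct.tmul_mul_tmul, mul_one, one_mul]
  exact e ▸ h p w

/-- The even generator `x_i` of the extended polynomials. -/
noncomputable def px {n : ℕ} (i : Fin n) : Poly n := ofPoly (MvPolynomial.X i)

/-- The odd generator `ω_i` of the extended polynomials. -/
noncomputable def pom {n : ℕ} (i : Fin n) : Poly n :=
  ofExt (ExteriorAlgebra.ι ℚ (Pi.single i (1 : ℚ)))

/-- The polynomial `s_i(x_j)`: for `i < n` the reflection `s_i` swaps `x_i` and `x_{i+1}`, and
`s_n` negates `x_n` and fixes the other variables. -/
noncomputable def sX {n : ℕ} (i j : Fin n) : MvPolynomial (Fin n) ℚ :=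
  if h : i.val + 1 < n then MvPolynomial.X (Equiv.swap i ⟨i.val + 1, h⟩ j)
  else if j = i then -MvPolynomial.X j else MvPolynomial.X j

/-- The extended polynomial `s_i(ω_j) = ω_j + δ_{ij} (x_i² - x_{i+1}²) ω_{i+1}` for `i < n`,
and `s_n(ω_j) = ω_j`. -/
noncomputable def sOm {n : ℕ} (i j : Fin n) : Poly n :=
  if h : i.val + 1 < n then
    if j = i then pom j + (px i ^ 2 - px ⟨i.val + 1, h⟩ ^ 2) * pom ⟨i.val + 1, h⟩ else pom j
  else pom j

theorem sum_sq_eq_zero {n : ℕ} {A : Type*} [Ring A] [Algebra ℚ A] (a : Fin n → A)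
    (h : ∀ j k, a j * a k = -(a k * a j)) (v : Fin n → ℚ) :
    Fintype.linearCombination ℚ a v * Fintype.linearCombination ℚ a v = 0 := by
  have key : Fintype.linearCombination ℚ a v * Fintype.linearCombination ℚ a v
      = -(Fintype.linearCombination ℚ a v * Fintype.linearCombination ℚ a v) := by
    simp only [Fintype.linearCombination_apply, Finset.sum_mul_sum]
    rw [← Finset.sum_neg_distrib]
    rw [Finset.sum_comm]
    refine Finset.sum_congr rfl fun j _ => ?_
    rw [← Finset.sum_neg_distrib]
    refine Finset.sum_congr rfl fun k _ => ?_
    rw [smul_mul_smul_comm, smul_mul_smul_comm, h k j, smul_neg, mul_comm (v k)]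
  have h2 : (2 : ℚ) • (Fintype.linearCombination ℚ a v * Fintype.linearCombination ℚ a v) = 0 := by
    rw [two_smul]
    nth_rewrite 1 [key]
    exact neg_add_cancel _
  exact (smul_eq_zero.mp h2).resolve_left two_ne_zero

theorem comm_left {n : ℕ} (p : MvPolynomial (Fin n) ℚ) (f : Poly n) :
    Commute (ofPoly p) f := by
  induction f using poly_induction with
  | h q w =>
    refine Commute.mul_right ?_ (ofPoly_comm_ofExt p w)
    rw [Commute, SemiconjBy, ← map_mul, mul_comm, map_mul]
  | hadd a b ha hb => exact ha.add_right hb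

theorem pom_mul {n : ℕ} (j k : Fin n) : pom j * pom k = -(pom k * pom j) := by
  rw [pom, pom, ← map_mul ofExt, ← map_mul ofExt, ← map_neg ofExt]
  exact congrArg _ (eq_neg_of_add_eq_zero_left (ExteriorAlgebra.ι_add_mul_swap _ _))

theorem px_comm {n : ℕ} (i : Fin n) (f : Poly n) : Commute (px i) f := comm_left _ f

theorem sOm_mul {n : ℕ} (i j k : Fin n) : sOm i j * sOm i k = -(sOm i k * sOm i j) := by
  have hc : ∀ (c d a b a' b' : Poly n), (∀ f, Commute c f) → (∀ f, Commute d f) →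
      a * b = -(b * a) → a * b' = -(b' * a) → a' * b = -(b * a') → a' * b' = -(b' * a') →
      (a + c * a') * (b + d * b') = -((b + d * b') * (a + c * a')) := by
    intro c d a b a' b' hc hd h1 h2 h3 h4
    have e1 : a * (d * b') = -(d * b' * a) := by
      rw [← mul_assoc, ← (hd a).eq, mul_assoc, h2, mul_neg, mul_assoc]
    have e2 : c * a' * b = -(b * (c * a')) := by
      rw [mul_assoc, h3, mul_neg, ← mul_assoc, (hc b).eq, mul_assoc]
    have e3 : c * a' * (d * b') = -(d * b' * (c * a')) := by
      have e5 : d * b' * (c * a') = c * (d * (b' * a')) := by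
        rw [← mul_assoc, ← (hc (d * b')).eq]
        simp only [mul_assoc]
      rw [e5, mul_assoc, ← mul_assoc a', ← (hd a').eq, mul_assoc, h4]
      simp only [mul_neg]
    rw [add_mul, mul_add, mul_add, h1, e1, e2, e3, add_mul, mul_add, mul_add]
    abel
  have hs : ∀ m, ∃ (c b : Poly n), (∀ f, Commute c f) ∧ sOm i m = pom m + c * b ∧
      ∃ r, b = pom r := by
    intro m
    unfold sOm
    split_ifs with h hm
    · exact ⟨_, _, fun f => ((px_comm i f).pow_left 2).sub_left ((px_comm _ f).pow_left 2), rfl,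
        _, rfl⟩
    · exact ⟨0, pom m, fun f => Commute.zero_left f, by simp, m, rfl⟩
    · exact ⟨0, pom m, fun f => Commute.zero_left f, by simp, m, rfl⟩
  obtain ⟨c, a', hcc, e, r, rfl⟩ := hs j
  obtain ⟨d, b', hdc, e', t, rfl⟩ := hs k
  rw [e, e']
  exact hc c d _ _ _ _ hcc hdc (pom_mul _ _) (pom_mul _ _) (pom_mul _ _) (pom_mul _ _)

/-! ### Simple reflections and Demazure operators -/

/-- The simple reflection `s_i`, the algebra endomorphism of the extended polynomials with
`x_j ↦ s_i(x_j)` and `ω_j ↦ s_i(ω_j)`. -/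
noncomputable def refl {n : ℕ} (i : Fin n) : Poly n →ₐ[ℚ] Poly n :=
  (Algebra.TensorProduct.lift
    (ofPoly.comp (MvPolynomial.aeval (sX i)))
    (ExteriorAlgebra.lift ℚ
      ⟨Fintype.linearCombination ℚ (sOm i), sum_sq_eq_zero (sOm i) (sOm_mul i)⟩)
    (fun _ _ => comm_left _ _) : MvPolynomial (Fin n) ℚ ⊗[ℚ] Ext n →ₐ[ℚ] Poly n)

theorem refl_px {n : ℕ} (i j : Fin n) : refl i (px j) = ofPoly (sX i j) :=
  (Algebra.TensorProduct.lift_tmul _ _ _ _ _).trans (by simp)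

theorem refl_pom {n : ℕ} (i j : Fin n) : refl i (pom j) = sOm i j :=
  (Algebra.TensorProduct.lift_tmul _ _ _ _ _).trans (by simp)

/-- The denominator `x_i - s_i(x_i)` of the Demazure operator `∂_i`. -/
noncomputable def root {n : ℕ} (i : Fin n) : Poly n := px i - refl i (px i)

theorem root_eq {n : ℕ} (i : Fin n) : root i = ofPoly (MvPolynomial.X i - sX i i) := by
  rw [root, refl_px, px, map_sub]

theorem root_poly_ne_zero {n : ℕ} (i : Fin n) :
    (MvPolynomial.X i - sX i i : MvPolynomial (Fin n) ℚ) ≠ 0 := by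
  unfold sX
  by_cases h : i.val + 1 < n
  · rw [dif_pos h, Equiv.swap_apply_left, sub_ne_zero]
    intro e
    have := congrArg Fin.val (MvPolynomial.X_injective e)
    simp at this
  · rw [dif_neg h, if_pos rfl]
    intro e
    have := congrArg (MvPolynomial.eval fun _ => (1 : ℚ)) e
    norm_num at this

theorem ofPoly_mul_injective {n : ℕ} (p : MvPolynomial (Fin n) ℚ) (hp : p ≠ 0) {f g : Poly n}
    (h : ofPoly p * f = ofPoly p * g) : f = g := by
  have hs : ∀ f : MvPolynomial (Fin n) ℚ ⊗[ℚ] Ext n, (p ⊗ₜ[ℚ] (1 : Ext n)) * f = p • f := by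
    intro f
    induction f using TensorProduct.induction_on with
    | zero => simp
    | tmul q w => simp [Algebra.TensorProduct.tmul_mul_tmul, TensorProduct.smul_tmul']
    | add a b ha hb => rw [mul_add, ha, hb, smul_add]
  exact smul_right_injective (MvPolynomial (Fin n) ℚ ⊗[ℚ] Ext n) hp
    (((hs f).symm.trans h).trans (hs g))

theorem root_mul_cancel {n : ℕ} (i : Fin n) {f g : Poly n} (h : root i * f = root i * g) :
    f = g := by
  rw [root_eq] at h
  exact ofPoly_mul_injective _ (root_poly_ne_zero i) h

/-- The numerator `f - s_i(f)` is divisible by `x_i - s_i(x_i)`. -/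
theorem exists_demazure {n : ℕ} (i : Fin n) (f : Poly n) :
    ∃ g : Poly n, root i * g = f - refl i f := by
  have hadd : ∀ a b : Poly n, (∃ g, root i * g = a - refl i a) → (∃ g, root i * g = b - refl i b) →
      ∃ g, root i * g = (a + b) - refl i (a + b) := by
    rintro a b ⟨g, hg⟩ ⟨k, hk⟩
    exact ⟨g + k, by rw [mul_add, hg, hk, map_add]; abel⟩
  have hmul : ∀ a b : Poly n, (∃ g, root i * g = a - refl i a) → (∃ g, root i * g = b - refl i b) →
      ∃ g, root i * g = (a * b) - refl i (a * b) := by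
    rintro a b ⟨g, hg⟩ ⟨k, hk⟩
    refine ⟨g * b + refl i a * k, ?_⟩
    have hc : Commute (root i) (refl i a) := root_eq i ▸ comm_left _ _
    rw [mul_add, ← mul_assoc, hg, ← mul_assoc, hc.eq, mul_assoc, hk, map_mul, sub_mul, mul_sub]
    abel
  have hsc : ∀ r : ℚ, ∃ g, root i * g = algebraMap ℚ (Poly n) r - refl i (algebraMap ℚ _ r) :=
    fun r => ⟨0, by rw [AlgHom.commutes]; simp⟩
  have hx : ∀ j, ∃ g, root i * g = px j - refl i (px j) := by
    intro j
    by_cases hj : j = i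
    · exact ⟨1, by rw [hj, mul_one, root]⟩
    by_cases h : i.val + 1 < n
    · by_cases hj' : j = ⟨i.val + 1, h⟩
      · refine ⟨-1, ?_⟩
        rw [root, refl_px, refl_px, hj']
        simp [sX, h, px]
      · refine ⟨0, ?_⟩
        rw [refl_px]
        simp [sX, h, px, Equiv.swap_apply_of_ne_of_ne hj hj']
    · refine ⟨0, ?_⟩
      rw [refl_px]
      simp [sX, h, px, hj]
  have hom : ∀ j, ∃ g, root i * g = pom j - refl i (pom j) := by
    intro j
    rw [refl_pom]
    unfold sOm
    split_ifs with h hj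
    · refine ⟨-((px i + px ⟨i.val + 1, h⟩) * pom ⟨i.val + 1, h⟩), ?_⟩
      have hr : root i = px i - px ⟨i.val + 1, h⟩ := by
        rw [root, refl_px]; simp [sX, h, px]
      have hc : px i * px ⟨i.val + 1, h⟩ = px ⟨i.val + 1, h⟩ * px i := comm_left _ _
      rw [hr, mul_neg, ← mul_assoc, sub_add_cancel_left]
      congr 2
      rw [mul_add, sub_mul, sub_mul, hc, sq, sq]
      abel
    · exact ⟨0, by simp⟩
    · exact ⟨0, by simp⟩
  induction f using poly_induction with
  | hadd a b ha hb => exact hadd a b ha hb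
  | h p w =>
    refine hmul _ _ ?_ ?_
    · induction p using MvPolynomial.induction_on with
      | C a =>
        have := hsc a
        rwa [← AlgHom.commutes (ofPoly (n := n))] at this
      | add p q hp hq =>
        rw [map_add]
        exact hadd _ _ hp hq
      | mul_X p j hp =>
        rw [map_mul]
        exact hmul _ _ hp (hx j)
    · induction w using ExteriorAlgebra.induction with
      | algebraMap r =>
        rw [AlgHom.commutes]
        exact hsc r
      | ι v =>
        have : (ofExt (ExteriorAlgebra.ι ℚ v) : Poly n)
            = ∑ j, algebraMap ℚ (Poly n) (v j) * pom j := by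
          conv_lhs => rw [← Finset.univ_sum_single v]
          rw [map_sum, map_sum]
          refine Finset.sum_congr rfl fun j _ => ?_
          rw [← Algebra.smul_def, pom, ← map_smul, ← map_smul, ← Pi.single_smul]
          simp
        rw [this]
        refine Finset.sum_induction _ (fun a => ∃ g, root i * g = a - refl i a) hadd
          ⟨0, by simp⟩ fun j _ => hmul _ _ (hsc _) (hom j)
      | mul a b ha hb =>
        rw [map_mul]
        exact hmul _ _ ha hb
      | add a b ha hb =>
        rw [map_add]
        exact hadd _ _ ha hb

/-- The Demazure operator `∂_i = (id - s_i) / (x_i - s_i(x_i))` on extended polynomials. -/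
noncomputable def demazure {n : ℕ} (i : Fin n) : Module.End ℚ (Poly n) where
  toFun f := (exists_demazure i f).choose
  map_add' f g := root_mul_cancel i (by
    rw [mul_add, (exists_demazure i f).choose_spec, (exists_demazure i g).choose_spec,
      (exists_demazure i (f + g)).choose_spec, map_add]
    abel)
  map_smul' r f := root_mul_cancel i (by
    rw [RingHom.id_apply, mul_smul_comm, (exists_demazure i f).choose_spec,
      (exists_demazure i (r • f)).choose_spec, map_smul, smul_sub])

/-- The defining property of `∂_i`; by `root_mul_cancel` it determines `∂_i`. -/
theorem root_mul_demazure {n : ℕ} (i : Fin n) (f : Poly n) :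
    root i * demazure i f = f - refl i f :=
  (exists_demazure i f).choose_spec

/-! ### The extended nilHecke algebra -/

/-- The extended nilHecke algebra of type `B`: the algebra of operators on extended polynomials
generated by all multiplications and the Demazure operators. -/
noncomputable def NHext (n : ℕ) : Subalgebra ℚ (Module.End ℚ (Poly n)) :=
  Algebra.adjoin ℚ
    (Set.range (fun f : Poly n => LinearMap.mulLeft ℚ f) ∪ Set.range (demazure (n := n)))

/-- Names of the generators `x_i`, `∂_i` of the type `B` nilHecke algebra. -/
inductive NHGen (n : ℕ) : Type
  | x (i : Fin n)
  | d (i : Fin n)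

/-- Names of the generators `x_i`, `∂_i`, `ω_i` of the extended algebra. -/
inductive ExtGen (n : ℕ) : Type
  | x (i : Fin n)
  | d (i : Fin n)
  | om (i : Fin n)

/-- The generators `x_i`, `∂_i`, `ω_i` of `NHext n` as operators. -/
noncomputable def opGen (n : ℕ) : ExtGen n → NHext n
  | .x i => ⟨LinearMap.mulLeft ℚ (px i), Algebra.subset_adjoin (Or.inl ⟨px i, rfl⟩)⟩
  | .d i => ⟨demazure i, Algebra.subset_adjoin (Or.inr ⟨i, rfl⟩)⟩
  | .om i => ⟨LinearMap.mulLeft ℚ (pom i), Algebra.subset_adjoin (Or.inl ⟨pom i, rfl⟩)⟩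

/-- Parity of the generators: the `ω_i` are odd, the `x_i` and `∂_i` are even. -/
def parity {n : ℕ} : ExtGen n → ZMod 2
  | .x _ => 0
  | .d _ => 0
  | .om _ => 1

/-- The even (`p = 0`) and odd (`p = 1`) part of an algebra generated by `g`: the span of the
words in the generators in which the number of `ω`'s is congruent to `p` modulo `2`. -/
def parityPart {n : ℕ} {A : Type} [Ring A] [Algebra ℚ A] (g : ExtGen n → A) (p : ZMod 2) :
    Submodule ℚ A :=
  Submodule.span ℚ {a | ∃ w : List (ExtGen n), (w.map parity).sum = p ∧ a = (w.map g).prod}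

/-! ### The presented algebras -/

section Presentation

variable (n : ℕ)

/-- The generator `x_i` in the free algebra on `x_i, ∂_i`. -/
noncomputable abbrev fX {n : ℕ} (i : Fin n) : FreeAlgebra ℚ (NHGen n) := FreeAlgebra.ι ℚ (NHGen.x i)

/-- The generator `∂_i` in the free algebra on `x_i, ∂_i`. -/
noncomputable abbrev fD {n : ℕ} (i : Fin n) : FreeAlgebra ℚ (NHGen n) := FreeAlgebra.ι ℚ (NHGen.d i)

/-- Defining relations of the type `B` nilHecke algebra. -/
inductive NHRel : FreeAlgebra ℚ (NHGen n) → FreeAlgebra ℚ (NHGen n) → Prop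
  | x_comm (i j : Fin n) : NHRel (fX i * fX j) (fX j * fX i)
  | d_sq (i : Fin n) : NHRel (fD i * fD i) 0
  | d_comm (i j : Fin n) (h : i.val + 1 < j.val ∨ j.val + 1 < i.val) :
      NHRel (fD i * fD j) (fD j * fD i)
  | d_braid (i j : Fin n) (h : j.val = i.val + 1) (hj : j.val + 1 < n) :
      NHRel (fD i * fD j * fD i) (fD j * fD i * fD j)
  | d_braid_last (i j : Fin n) (h : j.val = i.val + 1) (hj : j.val + 1 = n) :
      NHRel (fD i * fD j * fD i * fD j) (fD j * fD i * fD j * fD i)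
  | d_x_comm (i j : Fin n) (h : j ≠ i) (h' : j.val ≠ i.val + 1) :
      NHRel (fD i * fX j) (fX j * fD i)
  | d_x (i j : Fin n) (h : j.val = i.val + 1) : NHRel (fD i * fX i - fX j * fD i) 1
  | d_x_succ (i j : Fin n) (h : j.val = i.val + 1) : NHRel (fD i * fX j - fX i * fD i) (-1)
  | d_x_last (i : Fin n) (h : i.val + 1 = n) : NHRel (fD i * fX i + fX i * fD i) 1

/-- The type `B` nilHecke algebra. -/
abbrev NH : Type := RingQuot (NHRel n)

/-- The generator `x_i` in the free algebra on `x_i, ∂_i, ω_i`. -/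
noncomputable abbrev eX {n : ℕ} (i : Fin n) : FreeAlgebra ℚ (ExtGen n) :=
  FreeAlgebra.ι ℚ (ExtGen.x i)

/-- The generator `∂_i` in the free algebra on `x_i, ∂_i, ω_i`. -/
noncomputable abbrev eD {n : ℕ} (i : Fin n) : FreeAlgebra ℚ (ExtGen n) :=
  FreeAlgebra.ι ℚ (ExtGen.d i)

/-- The generator `ω_i` in the free algebra on `x_i, ∂_i, ω_i`. -/
noncomputable abbrev eOm {n : ℕ} (i : Fin n) : FreeAlgebra ℚ (ExtGen n) :=
  FreeAlgebra.ι ℚ (ExtGen.om i)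

/-- The inclusion of generator names. -/
def NHGen.toExt {n : ℕ} : NHGen n → ExtGen n
  | .x i => .x i
  | .d i => .d i

/-- The inclusion of the free algebra on `x_i, ∂_i` into the one on `x_i, ∂_i, ω_i`. -/
noncomputable def freeIncl : FreeAlgebra ℚ (NHGen n) →ₐ[ℚ] FreeAlgebra ℚ (ExtGen n) :=
  FreeAlgebra.lift ℚ fun g => FreeAlgebra.ι ℚ g.toExt

/-- Defining relations of the smash product of the type `B` nilHecke algebra with
`⋀[ω_1, …, ω_n]`: those of each factor, and the mixed relations. -/
inductive SmashRel : FreeAlgebra ℚ (ExtGen n) → FreeAlgebra ℚ (ExtGen n) → Prop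
  | nh (a b : FreeAlgebra ℚ (NHGen n)) (h : NHRel n a b) : SmashRel (freeIncl n a) (freeIncl n b)
  | om_sq (i : Fin n) : SmashRel (eOm i * eOm i) 0
  | om_anti (i j : Fin n) : SmashRel (eOm i * eOm j) (-(eOm j * eOm i))
  | x_om (i j : Fin n) : SmashRel (eX i * eOm j) (eOm j * eX i)
  | d_om (i j : Fin n) (h : i ≠ j) : SmashRel (eD i * eOm j) (eOm j * eD i)
  | d_om_shift (i j : Fin n) (h : j.val = i.val + 1) :
      SmashRel (eD i * (eOm i - eX j ^ 2 * eOm j)) ((eOm i - eX j ^ 2 * eOm j) * eD i)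
  | d_om_last (i j : Fin n) (h : i.val + 1 = n) : SmashRel (eD i * eOm j) (eOm j * eD i)

/-- The smash product of the type `B` nilHecke algebra with `⋀[ω_1, …, ω_n]`. -/
abbrev Smash : Type := RingQuot (SmashRel n)

/-- The generators of the smash product. -/
noncomputable def smashGen (g : ExtGen n) : Smash n :=
  RingQuot.mkAlgHom ℚ (SmashRel n) (FreeAlgebra.ι ℚ g)

/-- The canonical map from the type `B` nilHecke algebra to the smash product. -/
noncomputable def nhToSmash : NH n →ₐ[ℚ] Smash n :=
  RingQuot.liftAlgHom ℚ ⟨(RingQuot.mkAlgHom ℚ (SmashRel n)).comp (freeIncl n),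
    fun {a b} h => RingQuot.mkAlgHom_rel ℚ (SmashRel.nh a b h)⟩

theorem smashGen_om_mul (j k : Fin n) : smashGen n (.om j) * smashGen n (.om k)
    = -(smashGen n (.om k) * smashGen n (.om j)) := by
  simp only [smashGen, ← map_mul, ← map_neg]
  exact RingQuot.mkAlgHom_rel ℚ (SmashRel.om_anti j k)

/-- The canonical map from `⋀[ω_1, …, ω_n]` to the smash product. -/
noncomputable def extToSmash : Ext n →ₐ[ℚ] Smash n :=
  ExteriorAlgebra.lift ℚ ⟨Fintype.linearCombination ℚ fun j => smashGen n (.om j),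
    sum_sq_eq_zero _ (smashGen_om_mul n)⟩

/-- The multiplication map `h ⊗ λ ↦ h λ` from the tensor product of the type `B` nilHecke algebra
and the exterior algebra to the smash product. -/
noncomputable def smashMul : NH n ⊗[ℚ] Ext n →ₗ[ℚ] Smash n :=
  TensorProduct.lift ((LinearMap.mul ℚ (Smash n)).compl₁₂ (nhToSmash n).toLinearMap
    (extToSmash n).toLinearMap)

end Presentation

end ExtNilHecke

namespace ExtNilHecke

/-! ### Normal forms in type `B` nilCoxeter algebras -/

/-! The presented algebra acts on the extended polynomials, and the image of this action is the
extended nilHecke algebra. That the action exists comes from two facts. The Demazure operators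
satisfy the nilCoxeter relations, by clearing denominators (`IsDividedDifference`) and the braid
relations of the reflections. They are also linear over `s_i`-invariants, and `ω_i - x_{i+1}²
ω_{i+1}` is such an invariant. The substance of the theorem is injectivity, which has two layers.

First, the nilHecke algebra acts faithfully on ordinary polynomials (`eq_zero_of_nhAct_ofPoly`). It
is spanned over the polynomials by `2 ^ n * n!` standard words in the `∂_i` (`nhSum_surjective`).
Viewed as functions into the field of rational functions, these words span a space containing the `2
^ n * n!` signed permutations, because `s_i = 1 - (x_i - s_i(x_i)) ∂_i`. Distinct signed
permutations are linearly independent by Dedekind's lemma, so the dimension count forces the words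
to be independent as well (`linearIndependent_nhWord`).

Second, the mixed relations move every `ω` to the left, so the products `λ h` span the smash product
(`smashMulLeft_surjective`). Such a product sends a polynomial `p` to `h(p) ⊗ λ`. Expanding along a
basis of the exterior algebra, a combination that kills all polynomials has all its coefficients `h`
acting by zero, hence equal to zero (`eq_zero_of_smashAct_ofPoly`). This yields at once the
faithfulness of the action and the bijectivity of `λ ⊗ h ↦ λ h`. An anti-involution fixing the
generators converts the latter into the statement for `h ⊗ λ ↦ h λ`.

The gradings come from the automorphism that negates the `ω_i`: the even and odd parts lie in its
`±1`-eigenspaces. -/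

/-- The relations of the type `B` nilCoxeter algebra, for generators numbered from the special
node `0` of the Dynkin diagram. -/
structure IsNilCoxeterB {A : Type*} [Ring A] (e : ℕ → A) : Prop where
  sq (i : ℕ) : e i * e i = 0
  comm (i j : ℕ) (h : i + 1 < j) : e i * e j = e j * e i
  braid (i : ℕ) : e (i + 1) * e (i + 2) * e (i + 1) = e (i + 2) * e (i + 1) * e (i + 2)
  braid_zero : e 1 * e 0 * e 1 * e 0 = e 0 * e 1 * e 0 * e 1

section NilCoxeter

variable {A : Type*} [Ring A]

/-- The longest of the coset representatives `cosetWords e m`. -/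
def longestWord (e : ℕ → A) : ℕ → A
  | 0 => e 0
  | m + 1 => e (m + 1) * longestWord e m * e (m + 1)

/-- The basis elements of the nilCoxeter algebra of type `B_{m+1}` which belong to the minimal
length representatives of the right cosets of the Weyl group of type `B_m`. -/
def cosetWords (e : ℕ → A) : ℕ → List A
  | 0 => [1, e 0]
  | m + 1 => 1 :: longestWord e (m + 1) :: (cosetWords e m).map (e (m + 1) * ·)

/-- The standard basis elements of the nilCoxeter algebra of type `B_m`. -/
def standardWords (e : ℕ → A) : ℕ → List A
  | 0 => [1]
  | m + 1 => (standardWords e m ×ˢ cosetWords e m).map fun w => w.1 * w.2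

theorem length_cosetWords (e : ℕ → A) (m : ℕ) : (cosetWords e m).length = 2 * (m + 1) := by
  induction m with
  | zero => rfl
  | succ m ih => simp [cosetWords, ih]; ring

/-- This is the order of the Weyl group of type `B_m`. Only the length of the list matters: the
words need not be distinct in `A`, and an upper bound on the size of a spanning set suffices for the
later dimension count. -/
theorem length_standardWords (e : ℕ → A) (m : ℕ) :
    (standardWords e m).length = 2 ^ m * m.factorial := by
  induction m with
  | zero => rfl
  | succ m ih =>
    simp only [standardWords, List.length_map, List.length_product, ih, length_cosetWords,
      Nat.factorial_succ]
    ring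

theorem longestWord_mem_cosetWords (e : ℕ → A) (m : ℕ) : longestWord e m ∈ cosetWords e m := by
  cases m <;> simp [longestWord, cosetWords]

theorem one_mem_cosetWords (e : ℕ → A) (m : ℕ) : 1 ∈ cosetWords e m := by
  cases m <;> simp [cosetWords]

theorem one_mem_standardWords (e : ℕ → A) (m : ℕ) : 1 ∈ standardWords e m := by
  induction m with
  | zero => simp [standardWords]
  | succ m ih =>
    refine List.mem_map.2 ⟨(1, 1), ?_, mul_one _⟩
    exact List.mem_product.2 ⟨ih, one_mem_cosetWords e m⟩

namespace IsNilCoxeterB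

variable {e : ℕ → A} (he : IsNilCoxeterB e)
include he

theorem commute_longestWord {m k : ℕ} (h : m + 1 < k) : Commute (longestWord e m) (e k) := by
  induction m with
  | zero => exact he.comm 0 k h
  | succ m ih =>
    have h1 : Commute (e (m + 1)) (e k) := he.comm _ _ h
    exact (h1.mul_left (ih (by omega))).mul_left h1

theorem commute_cosetWords {m k : ℕ} (h : m + 1 < k) {u : A} (hu : u ∈ cosetWords e m) :
    Commute u (e k) := by
  induction m generalizing u with
  | zero =>
    simp only [cosetWords, List.mem_cons, List.not_mem_nil, or_false] at hu
    obtain rfl | rfl := hu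
    · exact Commute.one_left _
    · exact he.comm 0 k h
  | succ m ih =>
    simp only [cosetWords, List.mem_cons, List.mem_map] at hu
    obtain rfl | rfl | ⟨v, hv, rfl⟩ := hu
    · exact Commute.one_left _
    · exact he.commute_longestWord h
    · exact Commute.mul_left (he.comm _ _ h) (ih (by omega) hv)

/-- The longest coset word `e m ⋯ e 0 ⋯ e m` corresponds to the sign change of one coordinate, which
commutes with the group acting on the earlier coordinates. In the algebra, `m = 1` is the four-term
braid relation, and for larger `m` the case `l = m - 1` follows from two three-term braid moves. -/
theorem commute_longestWord_of_lt {m l : ℕ} (h : l < m) : Commute (longestWord e m) (e l) := by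
  induction m with
  | zero => omega
  | succ m ih =>
    obtain rfl | hl := Nat.eq_or_lt_of_le (Nat.lt_succ_iff.1 h)
    · cases l with
      | zero => simpa only [longestWord, mul_assoc, Commute, SemiconjBy] using he.braid_zero
      | succ m =>
        have hU : longestWord e m * e (m + 2) = e (m + 2) * longestWord e m :=
          he.commute_longestWord (by omega)
        have hb := he.braid m
        change e (m + 2) * (e (m + 1) * longestWord e m * e (m + 1)) * e (m + 2) * e (m + 1)
          = e (m + 1) * (e (m + 2) * (e (m + 1) * longestWord e m * e (m + 1)) * e (m + 2))
        calc _ = e (m + 2) * e (m + 1) * longestWord e m * (e (m + 1) * e (m + 2) * e (m + 1)) := by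
              simp only [mul_assoc]
          _ = e (m + 2) * e (m + 1) * (longestWord e m * e (m + 2)) * (e (m + 1) * e (m + 2)) := by
              rw [hb]; simp only [mul_assoc]
          _ = (e (m + 2) * e (m + 1) * e (m + 2)) * (longestWord e m * (e (m + 1) * e (m + 2))) := by
              rw [hU]; simp only [mul_assoc]
          _ = _ := by rw [← hb]; simp only [mul_assoc]
    · have h1 : Commute (e (m + 1)) (e l) := (he.comm l (m + 1) (by omega)).symm
      exact (h1.mul_left (ih hl)).mul_left h1

/-- Right multiplication by a generator kills a coset representative, or gives another one, or
amounts to left multiplication by a generator of the smaller algebra. -/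
theorem cosetWords_mul {m l : ℕ} (hl : l ≤ m) {u : A} (hu : u ∈ cosetWords e m) :
    u * e l = 0 ∨ u * e l ∈ cosetWords e m ∨ ∃ k < m, u * e l = e k * u := by
  induction m generalizing l u with
  | zero =>
    obtain rfl : l = 0 := by omega
    simp only [cosetWords, List.mem_cons, List.not_mem_nil, or_false] at hu ⊢
    obtain rfl | rfl := hu
    · simp
    · exact Or.inl (he.sq 0)
  | succ m ih =>
    have hu' := hu
    simp only [cosetWords, List.mem_cons, List.mem_map] at hu
    obtain rfl | rfl | ⟨v, hv, rfl⟩ := hu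
    · obtain rfl | hl := Nat.eq_or_lt_of_le hl
      · refine Or.inr (Or.inl ?_)
        simp only [cosetWords, List.mem_cons, List.mem_map]
        exact Or.inr (Or.inr ⟨1, one_mem_cosetWords e m, by rw [mul_one, one_mul]⟩)
      · exact Or.inr (Or.inr ⟨l, hl, by rw [mul_one, one_mul]⟩)
    · obtain rfl | hl := Nat.eq_or_lt_of_le hl
      · exact Or.inl (by rw [longestWord, mul_assoc, he.sq, mul_zero])
      · exact Or.inr (Or.inr ⟨l, hl, he.commute_longestWord_of_lt hl⟩)
    · obtain rfl | hl := Nat.eq_or_lt_of_le hl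
      · cases m with
        | zero =>
          simp only [cosetWords, List.mem_cons, List.not_mem_nil, or_false] at hv
          obtain rfl | rfl := hv
          · exact Or.inl (by rw [mul_one, he.sq])
          · exact Or.inr (Or.inl (longestWord_mem_cosetWords e 1))
        | succ m =>
          simp only [cosetWords, List.mem_cons, List.mem_map] at hv
          obtain rfl | rfl | ⟨w, hw, rfl⟩ := hv
          · exact Or.inl (by rw [mul_one, he.sq])
          · exact Or.inr (Or.inl (longestWord_mem_cosetWords e (m + 2)))
          -- Here `u = e (m + 2) * e (m + 1) * w` with `w` commuting with `e (m + 2)`. The new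
          -- factor slides past `w`, and the braid relation releases an `e (m + 1)` on the left.
          · refine Or.inr (Or.inr ⟨m + 1, by omega, ?_⟩)
            have hc : w * e (m + 2) = e (m + 2) * w := he.commute_cosetWords (by omega) hw
            have hb := he.braid m
            calc _ = e (m + 2) * e (m + 1) * (w * e (m + 2)) := by simp only [mul_assoc]
              _ = e (m + 2) * e (m + 1) * e (m + 2) * w := by rw [hc]; simp only [mul_assoc]
              _ = _ := by rw [← hb]; simp only [mul_assoc]
      · obtain h | h | ⟨k, hk, h⟩ := ih (Nat.lt_succ_iff.1 hl) hv
        · exact Or.inl (by rw [mul_assoc, h, mul_zero])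
        · refine Or.inr (Or.inl ?_)
          simp only [cosetWords, List.mem_cons, List.mem_map]
          exact Or.inr (Or.inr ⟨_, h, (mul_assoc _ _ _).symm⟩)
        -- The induction hypothesis gives `k < m`, strictly, so `e k` also commutes with the leading
        -- factor `e (m + 1)`.
        · refine Or.inr (Or.inr ⟨k, by omega, ?_⟩)
          rw [mul_assoc, h, ← mul_assoc, ← mul_assoc, he.comm k (m + 1) (by omega)]

/-- In a standard word `v * u`, the trichotomy `cosetWords_mul` applies to `u`: either the product
dies, or `u` absorbs the generator, or the generator crosses `u` as one of smaller index, to be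
absorbed by `v` inductively. -/
theorem span_standardWords_mul [Algebra ℚ A] {m l : ℕ} (hl : l < m) {a : A}
    (ha : a ∈ Submodule.span ℚ {w | w ∈ standardWords e m}) :
    a * e l ∈ Submodule.span ℚ {w | w ∈ standardWords e m} := by
  induction m generalizing l a with
  | zero => omega
  | succ m ih =>
    have key : ∀ v ∈ Submodule.span ℚ {w | w ∈ standardWords e m}, ∀ u ∈ cosetWords e m,
        v * u ∈ Submodule.span ℚ {w | w ∈ standardWords e (m + 1)} := by
      intro v hv u hu
      induction hv using Submodule.span_induction with
      | mem v hv =>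
        exact Submodule.subset_span (List.mem_map.2 ⟨(v, u), List.mem_product.2 ⟨hv, hu⟩, rfl⟩)
      | zero => rw [zero_mul]; exact Submodule.zero_mem _
      | add v w _ _ hv hw => rw [add_mul]; exact Submodule.add_mem _ hv hw
      | smul r v _ hv => rw [smul_mul_assoc]; exact Submodule.smul_mem _ _ hv
    induction ha using Submodule.span_induction with
    | mem a ha =>
      obtain ⟨⟨v, u⟩, hvu, rfl⟩ := List.mem_map.1 ha
      obtain ⟨hv, hu⟩ := List.mem_product.1 hvu
      have hv' := Submodule.subset_span (R := ℚ) (s := {w | w ∈ standardWords e m}) hv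
      dsimp only at hu hv' ⊢
      rw [mul_assoc]
      obtain h | h | ⟨k, hk, h⟩ := he.cosetWords_mul (Nat.lt_succ_iff.1 hl) hu
      · rw [h, mul_zero]; exact Submodule.zero_mem _
      · exact key _ hv' _ h
      · rw [h, ← mul_assoc]
        exact key _ (ih hk hv') _ hu
    | zero => rw [zero_mul]; exact Submodule.zero_mem _
    | add v w _ _ hv hw => rw [add_mul]; exact Submodule.add_mem _ hv hw
    | smul r v _ hv => rw [smul_mul_assoc]; exact Submodule.smul_mem _ _ hv

end IsNilCoxeterB

theorem longestWord_mem_adjoin [Algebra ℚ A] (e : ℕ → A) (m : ℕ) :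
    longestWord e m ∈ Algebra.adjoin ℚ (Set.range e) := by
  induction m with
  | zero => exact Algebra.subset_adjoin ⟨0, rfl⟩
  | succ m ih =>
    have h := Algebra.subset_adjoin (R := ℚ) (s := Set.range e) ⟨m + 1, rfl⟩
    exact mul_mem (mul_mem h ih) h

theorem cosetWords_mem_adjoin [Algebra ℚ A] (e : ℕ → A) (m : ℕ) {u : A}
    (hu : u ∈ cosetWords e m) : u ∈ Algebra.adjoin ℚ (Set.range e) := by
  induction m generalizing u with
  | zero =>
    simp only [cosetWords, List.mem_cons, List.not_mem_nil, or_false] at hu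
    obtain rfl | rfl := hu
    · exact one_mem _
    · exact Algebra.subset_adjoin ⟨0, rfl⟩
  | succ m ih =>
    simp only [cosetWords, List.mem_cons, List.mem_map] at hu
    obtain rfl | rfl | ⟨v, hv, rfl⟩ := hu
    · exact one_mem _
    · exact longestWord_mem_adjoin e (m + 1)
    · exact mul_mem (Algebra.subset_adjoin ⟨m + 1, rfl⟩) (ih hv)

theorem standardWords_mem_adjoin [Algebra ℚ A] (e : ℕ → A) (m : ℕ) {u : A}
    (hu : u ∈ standardWords e m) : u ∈ Algebra.adjoin ℚ (Set.range e) := by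
  induction m generalizing u with
  | zero =>
    obtain rfl : u = 1 := by simpa [standardWords] using hu
    exact one_mem _
  | succ m ih =>
    obtain ⟨⟨v, w⟩, hvw, rfl⟩ := List.mem_map.1 hu
    obtain ⟨hv, hw⟩ := List.mem_product.1 hvw
    exact mul_mem (ih hv) (cosetWords_mem_adjoin e m hw)

/-- The standard words span the subalgebra generated by the `e i`. -/
theorem IsNilCoxeterB.span_standardWords [Algebra ℚ A] {e : ℕ → A} (he : IsNilCoxeterB e)
    {n : ℕ} (h0 : ∀ i, n ≤ i → e i = 0) :
    Submodule.span ℚ {w | w ∈ standardWords e n}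
      = Subalgebra.toSubmodule (Algebra.adjoin ℚ (Set.range e)) := by
  refine le_antisymm (Submodule.span_le.2 fun u hu => standardWords_mem_adjoin e n hu) ?_
  intro a ha
  -- The claim is made for all `v`, not just `v = 1`, so that the product case can apply it twice in
  -- succession.
  have key : ∀ v ∈ Submodule.span ℚ {w | w ∈ standardWords e n},
      v * a ∈ Submodule.span ℚ {w | w ∈ standardWords e n} := by
    induction (show a ∈ Algebra.adjoin ℚ (Set.range e) from ha) using Algebra.adjoin_induction with
    | mem x hx =>
      obtain ⟨i, rfl⟩ := hx
      intro v hv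
      by_cases hi : i < n
      · exact he.span_standardWords_mul hi hv
      · rw [h0 i (not_lt.1 hi), mul_zero]; exact Submodule.zero_mem _
    | algebraMap r =>
      intro v hv
      rw [← Algebra.commutes, ← Algebra.smul_def]
      exact Submodule.smul_mem _ _ hv
    | add x y hx hy ihx ihy =>
      intro v hv
      rw [mul_add]
      exact Submodule.add_mem _ (ihx hx v hv) (ihy hy v hv)
    | mul x y hx hy ihx ihy =>
      intro v hv
      rw [← mul_assoc]
      exact ihy hy _ (ihx hx _ hv)
  simpa using key 1 (Submodule.subset_span (one_mem_standardWords e n))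

end NilCoxeter

/-! ### Divided differences on a module -/

section Demazure

variable {R M : Type*} [CommRing R] [AddCommGroup M] [Module R M]

/-- The operator `D` is the divided difference `(1 - s) / a`, where `s` is an involution of the
module which is semilinear over the ring endomorphism `σ`, with `σ a = -a`. -/
structure IsDividedDifference (σ : R →+* R) (s : M →+ M) (a : R) (D : M → M) : Prop where
  semilinear (r : R) (m : M) : s (r • m) = σ r • s m
  involutive (m : M) : s (s m) = m
  root_neg : σ a = -a
  smul_apply (m : M) : a • D m = m - s m
  cancel {m m' : M} (h : a • m = a • m') : m = m'

namespace IsDividedDifference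

variable {σ τ : R →+* R} {s t : M →+ M} {a b : R} {D E : M → M}

/-- Applying `s` to `a • D m = m - s m` negates both the right side and the scalar `a`, so `s (D m)`
solves the equation that determines `D m`. -/
theorem fixed (hD : IsDividedDifference σ s a D) (m : M) : s (D m) = D m := by
  apply hD.cancel
  have h := congrArg s (hD.smul_apply m)
  rw [hD.semilinear, hD.root_neg, map_sub, hD.involutive, neg_smul] at h
  rw [hD.smul_apply, ← neg_inj, h, neg_sub]

theorem apply_apply (hD : IsDividedDifference σ s a D) (m : M) : D (D m) = 0 :=
  hD.cancel (by rw [hD.smul_apply, hD.fixed, sub_self, smul_zero])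

theorem smul_comm_apply (hD : IsDividedDifference σ s a D) (hE : IsDividedDifference τ t b E)
    (hb : σ b = b) (m : M) :
    (a * b) • D (E m) = m - t m - s m + s (t m) := by
  have h1 := hD.smul_apply (E m)
  have h2 := hE.smul_apply m
  have h3 := congrArg s h2
  rw [hD.semilinear, hb, map_sub] at h3
  linear_combination (norm := module) b • h1 + h2 - h3

theorem comm (hD : IsDividedDifference σ s a D) (hE : IsDividedDifference τ t b E)
    (hb : σ b = b) (ha : τ a = a) (hst : ∀ m, s (t m) = t (s m)) (m : M) :
    D (E m) = E (D m) := by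
  apply hD.cancel
  apply hE.cancel
  have h1 := hD.smul_comm_apply hE hb m
  have h2 := hE.smul_comm_apply hD ha m
  rw [hst] at h1
  linear_combination (norm := module) h1 - h2

/-- Multiplying by the three positive roots `a`, `b`, `a + b` of type `A_2` turns the threefold
divided difference into the alternating sum over the Weyl group. That sum is symmetric in `s` and
`t` once these satisfy the braid relation. -/
theorem smul_braid_apply (hD : IsDividedDifference σ s a D) (hE : IsDividedDifference τ t b E)
    (hb : σ b = a + b) (ha : τ a = a + b) (m : M) :
    (a * b * (a + b)) • D (E (D m))
      = m - s m - t m + t (s m) + s (t m) - s (t (s m)) := by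
  set g := D m with hg
  set h := E g with hh
  have sg : s g = g := hD.fixed m
  have h1 := hD.smul_apply h
  have h2 := hE.smul_apply g
  have h3 := congrArg s h2
  have h4 := hD.smul_apply m
  have h5 := congrArg t h4
  have h6 := congrArg s h5
  rw [hD.semilinear, hb, map_sub, sg] at h3
  rw [hE.semilinear, ha, map_sub] at h5
  rw [hE.semilinear, hD.semilinear, ha, map_add, hD.root_neg, hb, map_sub, map_sub] at h6
  -- The coefficients record which roots are still to be cleared when the denominators are removed
  -- one at a time, from the outermost operator inwards.
  linear_combination (norm := module) (b * (a + b)) • h1 + (a + b) • h2 - b • h3 + h4 - h5 + h6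

theorem braid (hD : IsDividedDifference σ s a D) (hE : IsDividedDifference τ t b E)
    (hb : σ b = a + b) (ha : τ a = a + b) (hst : ∀ m, s (t (s m)) = t (s (t m)))
    (hab : ∀ m m' : M, (a + b) • m = (a + b) • m' → m = m') (m : M) :
    D (E (D m)) = E (D (E m)) := by
  apply hD.cancel
  apply hE.cancel
  apply hab
  have h1 := hD.smul_braid_apply hE hb ha m
  have h2 := hE.smul_braid_apply hD (ha.trans (add_comm _ _)) (hb.trans (add_comm _ _)) m
  rw [hst] at h1
  linear_combination (norm := module) h1 - h2

/-- The factors `a`, `b`, `a + b`, `b + 2 * a` are the four positive roots of rank two type `B`, and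
the right side is the alternating sum over the dihedral group of order eight. -/
theorem smul_braid_four_apply (hD : IsDividedDifference σ s a D)
    (hE : IsDividedDifference τ t b E) (hb : σ b = b + 2 * a) (ha : τ a = a + b) (m : M) :
    (a * b * (a + b) * (b + 2 * a)) • D (E (D (E m)))
      = m - s m - t m + t (s m) + s (t m) - s (t (s m)) - t (s (t m)) + s (t (s (t m))) := by
  set g := E m with hg
  set h := D g with hh
  set k := E h with hk
  have h1 := hD.smul_apply k
  have h2 := hE.smul_apply h
  have h3 := congrArg s h2
  have h4 := hD.smul_apply g
  have h5 := congrArg t h4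
  have h6 := congrArg s h5
  have h7 := hE.smul_apply m
  have h8 := congrArg s h7
  have h9 := congrArg t h8
  have h10 := congrArg s h9
  have sh : s h = h := hD.fixed g
  have tg : t g = g := hE.fixed m
  simp only [hD.semilinear, hE.semilinear, map_add, map_sub, map_neg, map_mul, map_ofNat, hb, ha,
    hD.root_neg, hE.root_neg, sh, tg] at h1 h2 h3 h4 h5 h6 h7 h8 h9 h10
  linear_combination (norm := module) (b * (a + b) * (b + 2 * a)) • h1 + ((a + b) * (b + 2 * a)) • h2
    - (b * (a + b)) • h3 + (2 * (a + b)) • h4 - (b + 2 * a) • h5 + b • h6 + h7 - h8 + h9 - h10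

/-- The hypotheses on `σ b` and `τ a` are not symmetric, since the two roots have different lengths.
The opposite order of operators therefore needs its own computation, unlike in `braid`. -/
theorem smul_braid_four_apply' (hD : IsDividedDifference σ s a D)
    (hE : IsDividedDifference τ t b E) (hb : σ b = b + 2 * a) (ha : τ a = a + b) (m : M) :
    (a * b * (a + b) * (b + 2 * a)) • E (D (E (D m)))
      = m - s m - t m + t (s m) + s (t m) - s (t (s m)) - t (s (t m)) + t (s (t (s m))) := by
  set g := D m with hg
  set h := E g with hh
  set k := D h with hk
  have h1 := hE.smul_apply k
  have h2 := hD.smul_apply h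
  have h3 := congrArg t h2
  have h4 := hE.smul_apply g
  have h5 := congrArg s h4
  have h6 := congrArg t h5
  have h7 := hD.smul_apply m
  have h8 := congrArg t h7
  have h9 := congrArg s h8
  have h10 := congrArg t h9
  have th : t h = h := hE.fixed g
  have sg : s g = g := hD.fixed m
  simp only [hD.semilinear, hE.semilinear, map_add, map_sub, map_neg, map_mul, map_ofNat, hb, ha,
    hD.root_neg, hE.root_neg, th, sg] at h1 h2 h3 h4 h5 h6 h7 h8 h9 h10
  linear_combination (norm := module) (a * (a + b) * (b + 2 * a)) • h1 + ((a + b) * (b + 2 * a)) • h2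
    - (a * (b + 2 * a)) • h3 + (b + 2 * a) • h4 - (a + b) • h5 + a • h6 + h7 - h8 + h9 - h10

theorem braid_four (hD : IsDividedDifference σ s a D) (hE : IsDividedDifference τ t b E)
    (hb : σ b = b + 2 * a) (ha : τ a = a + b) (hst : ∀ m, s (t (s (t m))) = t (s (t (s m))))
    (h₁ : ∀ m m' : M, (a + b) • m = (a + b) • m' → m = m')
    (h₂ : ∀ m m' : M, (b + 2 * a) • m = (b + 2 * a) • m' → m = m') (m : M) :
    D (E (D (E m))) = E (D (E (D m))) := by
  apply hD.cancel
  apply hE.cancel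
  apply h₁
  apply h₂
  have h1 := hD.smul_braid_four_apply hE hb ha m
  have h2 := hD.smul_braid_four_apply' hE hb ha m
  rw [hst] at h1
  linear_combination (norm := module) h1 - h2

end IsDividedDifference

end Demazure

/-! ### The reflections and Demazure operators on extended polynomials -/

section Reflections

variable {n : ℕ}

/-- The extended polynomials are noncommutative. Treating them as a module over the commutative ring
of coefficients makes the general divided difference lemmas and the `module` tactic available. -/
noncomputable instance instModulePoly : Module (MvPolynomial (Fin n) ℚ) (Poly n) :=
  Module.compHom (Poly n) (ofPoly (n := n)).toRingHom

theorem poly_smul_def (p : MvPolynomial (Fin n) ℚ) (f : Poly n) : p • f = ofPoly p * f := rfl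

theorem poly_smul_cancel {p : MvPolynomial (Fin n) ℚ} (hp : p ≠ 0) {f g : Poly n}
    (h : p • f = p • g) : f = g :=
  ofPoly_mul_injective p hp h

theorem Poly.algHom_ext {B : Type*} [Semiring B] [Algebra ℚ B] {φ ψ : Poly n →ₐ[ℚ] B}
    (hx : ∀ i, φ (px i) = ψ (px i)) (hom : ∀ i, φ (pom i) = ψ (pom i)) : φ = ψ := by
  have h1 : φ.comp ofPoly = ψ.comp ofPoly := MvPolynomial.algHom_ext hx
  have h2 : φ.comp ofExt = ψ.comp ofExt := by
    refine ExteriorAlgebra.hom_ext (LinearMap.pi_ext' fun i => LinearMap.ext_ring ?_)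
    exact hom i
  ext f
  induction f using poly_induction with
  | h p w =>
    rw [map_mul, map_mul]
    exact congrArg₂ _ (DFunLike.congr_fun h1 p) (DFunLike.congr_fun h2 w)
  | hadd a b ha hb => rw [map_add, map_add, ha, hb]

/-- The action of the simple reflection `s_i` on polynomials. -/
noncomputable def polyRefl (i : Fin n) : MvPolynomial (Fin n) ℚ →ₐ[ℚ] MvPolynomial (Fin n) ℚ :=
  MvPolynomial.aeval (sX i)

theorem polyRefl_X (i j : Fin n) : polyRefl i (MvPolynomial.X j) = sX i j :=
  MvPolynomial.aeval_X _ _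

theorem refl_ofPoly (i : Fin n) (p : MvPolynomial (Fin n) ℚ) :
    refl i (ofPoly p) = ofPoly (polyRefl i p) := by
  have : (refl i).comp ofPoly = ofPoly.comp (polyRefl i) := by
    refine MvPolynomial.algHom_ext fun j => ?_
    exact (refl_px i j).trans (by rw [AlgHom.comp_apply, polyRefl_X])
  exact DFunLike.congr_fun this p

theorem refl_smul (i : Fin n) (p : MvPolynomial (Fin n) ℚ) (f : Poly n) :
    refl i (p • f) = polyRefl i p • refl i f := by
  rw [poly_smul_def, map_mul, refl_ofPoly, poly_smul_def]

theorem sX_self {i j : Fin n} (h : j.val = i.val + 1) : sX i i = MvPolynomial.X j := by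
  have hn : i.val + 1 < n := h ▸ j.isLt
  obtain rfl : j = ⟨i.val + 1, hn⟩ := Fin.ext h
  rw [sX, dif_pos hn, Equiv.swap_apply_left]

theorem sX_succ {i j : Fin n} (h : j.val = i.val + 1) : sX i j = MvPolynomial.X i := by
  have hn : i.val + 1 < n := h ▸ j.isLt
  obtain rfl : j = ⟨i.val + 1, hn⟩ := Fin.ext h
  rw [sX, dif_pos hn, Equiv.swap_apply_right]

theorem sX_last_self {i : Fin n} (h : i.val + 1 = n) : sX i i = -MvPolynomial.X i := by
  rw [sX, dif_neg (by omega), if_pos rfl]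

theorem sX_of_ne {i k : Fin n} (h : k ≠ i) (h' : k.val ≠ i.val + 1) :
    sX i k = MvPolynomial.X k := by
  rw [sX]
  split_ifs with hi
  · rw [Equiv.swap_apply_of_ne_of_ne h fun e => h' (congrArg Fin.val e)]
  · rfl

theorem sOm_self {i j : Fin n} (h : j.val = i.val + 1) :
    sOm i i = pom i + (MvPolynomial.X i ^ 2 - MvPolynomial.X j ^ 2 : MvPolynomial (Fin n) ℚ) •
      pom j := by
  have hn : i.val + 1 < n := h ▸ j.isLt
  obtain rfl : j = ⟨i.val + 1, hn⟩ := Fin.ext h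
  rw [sOm, dif_pos hn, if_pos rfl, poly_smul_def, map_sub, map_pow, map_pow]
  rfl

theorem sOm_of_ne {i k : Fin n} (h : k ≠ i) : sOm i k = pom k := by
  rw [sOm]
  split_ifs <;> rfl

theorem sOm_last {i : Fin n} (h : i.val + 1 = n) (k : Fin n) : sOm i k = pom k := by
  rw [sOm, dif_neg (by omega)]

theorem exists_succ_or_last (i : Fin n) : (∃ j : Fin n, j.val = i.val + 1) ∨ i.val + 1 = n := by
  by_cases h : i.val + 1 < n
  · exact Or.inl ⟨⟨_, h⟩, rfl⟩
  · exact Or.inr (by omega)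

/-- It suffices to check generators. On `ω_i` the coefficient `x_i² - x_{i+1}²` changes sign under
`s_i` while `ω_{i+1}` is fixed, so the two corrections cancel. -/
theorem refl_refl (i : Fin n) (f : Poly n) : refl i (refl i f) = f := by
  have : (refl i).comp (refl i) = AlgHom.id ℚ (Poly n) := by
    refine Poly.algHom_ext (fun k => ?_) fun k => ?_
    · simp only [AlgHom.comp_apply, AlgHom.id_apply, refl_px, refl_ofPoly]
      refine congrArg ofPoly ?_
      obtain ⟨j, h⟩ | h := exists_succ_or_last i
      · obtain rfl | hk := eq_or_ne k i
        · rw [sX_self h, polyRefl_X, sX_succ h]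
        obtain rfl | hk' := eq_or_ne k j
        · rw [sX_succ h, polyRefl_X, sX_self h]
        have hk'' : k.val ≠ i.val + 1 := fun e => hk' (Fin.ext (e.trans h.symm))
        rw [sX_of_ne hk hk'', polyRefl_X, sX_of_ne hk hk'']
      · obtain rfl | hk := eq_or_ne k i
        · rw [sX_last_self h, map_neg, polyRefl_X, sX_last_self h, neg_neg]
        · rw [sX_of_ne hk (by omega), polyRefl_X, sX_of_ne hk (by omega)]
    · simp only [AlgHom.comp_apply, AlgHom.id_apply, refl_pom]
      obtain ⟨j, h⟩ | h := exists_succ_or_last i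
      · obtain rfl | hk := eq_or_ne k i
        · have hj : j ≠ k := fun e => by simp [e] at h
          rw [sOm_self h, map_add, refl_smul, refl_pom, refl_pom, sOm_self h, sOm_of_ne hj]
          simp only [map_sub, map_pow, polyRefl_X, sX_self h, sX_succ h]
          module
        · rw [sOm_of_ne hk, refl_pom, sOm_of_ne hk]
      · rw [sOm_last h, refl_pom, sOm_last h]
  exact DFunLike.congr_fun this f

/-- The polynomial `x_i - s_i(x_i)`. -/
noncomputable def rootPoly (i : Fin n) : MvPolynomial (Fin n) ℚ := MvPolynomial.X i - sX i i

theorem rootPoly_eq {i j : Fin n} (h : j.val = i.val + 1) :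
    rootPoly i = MvPolynomial.X i - MvPolynomial.X j := by
  rw [rootPoly, sX_self h]

theorem rootPoly_last {i : Fin n} (h : i.val + 1 = n) :
    rootPoly i = 2 * MvPolynomial.X i := by
  rw [rootPoly, sX_last_self h]; ring

theorem rootPoly_smul_demazure (i : Fin n) (f : Poly n) :
    rootPoly i • demazure i f = f - refl i f := by
  rw [poly_smul_def, rootPoly, ← root_eq, root_mul_demazure]

theorem polyRefl_rootPoly (i : Fin n) : polyRefl i (rootPoly i) = -rootPoly i := by
  obtain ⟨j, h⟩ | h := exists_succ_or_last i
  · rw [rootPoly_eq h, map_sub, polyRefl_X, polyRefl_X, sX_self h, sX_succ h]; ring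
  · rw [rootPoly_last h, map_mul, map_ofNat, polyRefl_X, sX_last_self h]; ring

theorem isDividedDifference_demazure (i : Fin n) :
    IsDividedDifference (polyRefl i).toRingHom (refl i : Poly n →ₐ[ℚ] Poly n).toRingHom.toAddMonoidHom
      (rootPoly i) (demazure i) where
  semilinear := refl_smul i
  involutive := refl_refl i
  root_neg := polyRefl_rootPoly i
  smul_apply := rootPoly_smul_demazure i
  cancel := poly_smul_cancel (root_poly_ne_zero i)

theorem refl_comm {i j : Fin n} (h : i.val + 1 < j.val) (f : Poly n) :
    refl i (refl j f) = refl j (refl i f) := by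
  have : (refl i).comp (refl j) = (refl j : Poly n →ₐ[ℚ] Poly n).comp (refl i) := by
    obtain ⟨i', hi⟩ : ∃ i' : Fin n, i'.val = i.val + 1 := ⟨⟨i.val + 1, by omega⟩, rfl⟩
    refine Poly.algHom_ext (fun k => ?_) fun k => ?_
    · simp only [AlgHom.comp_apply, refl_px, refl_ofPoly]
      refine congrArg ofPoly ?_
      by_cases hk : k = i ∨ k = i'
      · have hki : k.val = i.val ∨ k.val = i.val + 1 := by
          obtain rfl | rfl := hk
          · exact Or.inl rfl
          · exact Or.inr hi
        have hj : sX j k = MvPolynomial.X k := sX_of_ne (by rintro rfl; omega) (by omega)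
        have hi1 : sX j i = MvPolynomial.X i := sX_of_ne (by rintro rfl; omega) (by omega)
        have hi2 : sX j i' = MvPolynomial.X i' := sX_of_ne (by rintro rfl; omega) (by omega)
        rw [hj, polyRefl_X]
        obtain rfl | rfl := hk
        · rw [sX_self hi, polyRefl_X, hi2]
        · rw [sX_succ hi, polyRefl_X, hi1]
      · have hk1 : k ≠ i := fun e => hk (Or.inl e)
        have hk2 : k.val ≠ i.val + 1 := fun e => hk (Or.inr (Fin.ext (e.trans hi.symm)))
        have hk3 := sX_of_ne hk1 hk2
        rw [hk3, polyRefl_X]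
        have hji : sX i j = MvPolynomial.X j := sX_of_ne (by rintro rfl; omega) (by omega)
        obtain ⟨j', hj⟩ | hj := exists_succ_or_last j
        · have hji' : sX i j' = MvPolynomial.X j' := sX_of_ne (by rintro rfl; omega) (by omega)
          obtain rfl | hkj := eq_or_ne k j
          · rw [sX_self hj, polyRefl_X, hji']
          obtain rfl | hkj' := eq_or_ne k j'
          · rw [sX_succ hj, polyRefl_X, hji]
          rw [sX_of_ne hkj fun e => hkj' (Fin.ext (e.trans hj.symm)), polyRefl_X, hk3]
        · obtain rfl | hkj := eq_or_ne k j
          · rw [sX_last_self hj, map_neg, polyRefl_X, hji]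
          · rw [sX_of_ne hkj (by omega), polyRefl_X, hk3]
    · simp only [AlgHom.comp_apply, refl_pom]
      obtain rfl | hk := eq_or_ne k i
      · have hj : k ≠ j := by rintro rfl; omega
        have hj2 : i' ≠ j := by rintro rfl; omega
        rw [sOm_of_ne hj, refl_pom, sOm_self hi, map_add, refl_smul, refl_pom, refl_pom,
          sOm_of_ne hj, sOm_of_ne hj2]
        simp only [map_sub, map_pow, polyRefl_X]
        rw [sX_of_ne hj (by omega), sX_of_ne hj2 (by omega)]
      · rw [sOm_of_ne hk, refl_pom]
        obtain ⟨j', hj⟩ | hj := exists_succ_or_last j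
        · obtain rfl | hkj := eq_or_ne k j
          · have hk' : j' ≠ i := by rintro rfl; omega
            rw [sOm_self hj, map_add, refl_smul, refl_pom, refl_pom, sOm_of_ne hk, sOm_of_ne hk']
            simp only [map_sub, map_pow, polyRefl_X]
            rw [sX_of_ne hk (by omega), sX_of_ne hk' (by omega)]
          · rw [sOm_of_ne hkj, refl_pom, sOm_of_ne hk]
        · rw [sOm_last hj, refl_pom, sOm_of_ne hk]
  exact DFunLike.congr_fun this f

theorem refl_braid {i j : Fin n} (h : j.val = i.val + 1) (hj : j.val + 1 < n) (f : Poly n) :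
    refl i (refl j (refl i f)) = refl j (refl i (refl j f)) := by
  have : (refl i).comp ((refl j).comp (refl i))
      = (refl j : Poly n →ₐ[ℚ] Poly n).comp ((refl i).comp (refl j)) := by
    obtain ⟨k, hk⟩ : ∃ k : Fin n, k.val = j.val + 1 := ⟨⟨j.val + 1, hj⟩, rfl⟩
    have xii := sX_self h
    have xij := sX_succ h
    have xik : sX i k = MvPolynomial.X k := sX_of_ne (by rintro rfl; omega) (by omega)
    have xji : sX j i = MvPolynomial.X i := sX_of_ne (by rintro rfl; omega) (by omega)
    have xjj := sX_self hk
    have xjk := sX_succ hk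
    refine Poly.algHom_ext (fun l => ?_) fun l => ?_
    · simp only [AlgHom.comp_apply, refl_px, refl_ofPoly]
      refine congrArg ofPoly ?_
      obtain rfl | hi := eq_or_ne l i
      · simp only [xii, xik, xji, xjj, polyRefl_X]
      obtain rfl | hj := eq_or_ne l j
      · simp only [xii, xij, xik, xji, xjj, xjk, polyRefl_X]
      obtain rfl | hk' := eq_or_ne l k
      · simp only [xij, xik, xji, xjk, polyRefl_X]
      have h1 := sX_of_ne hi fun e => hj (Fin.ext (e.trans h.symm))
      have h2 := sX_of_ne hj fun e => hk' (Fin.ext (e.trans hk.symm))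
      simp only [h1, h2, polyRefl_X]
    · simp only [AlgHom.comp_apply, refl_pom]
      have oii := sOm_self h
      have oij : sOm i j = pom j := sOm_of_ne (by rintro rfl; omega)
      have oik : sOm i k = pom k := sOm_of_ne (by rintro rfl; omega)
      have oji : sOm j i = pom i := sOm_of_ne (by rintro rfl; omega)
      have ojj := sOm_self hk
      have ojk : sOm j k = pom k := sOm_of_ne (by rintro rfl; omega)
      obtain rfl | hi := eq_or_ne l i
      -- Both sides send `ω_i` to `ω_i + (x_i² - x_k²) (ω_j + (x_j² - x_k²) ω_k)`.
      · simp only [oii, oij, oik, oji, ojj, map_add, refl_smul, refl_pom, map_sub, map_pow,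
          polyRefl_X, xii, xij, xik, xji, xjj]
        module
      obtain rfl | hj := eq_or_ne l j
      · simp only [oij, oik, ojj, ojk, map_add, refl_smul, refl_pom, map_sub, map_pow,
          polyRefl_X, xij, xik, xji, xjk]
        module
      simp only [sOm_of_ne hi, sOm_of_ne hj, refl_pom]
  exact DFunLike.congr_fun this f

/-- On the `ω`'s both sides reduce to `s_i² = 1`: the last reflection fixes every `ω`, and because
the correction coefficients involve squares, it fixes those too. -/
theorem refl_braid_last {i j : Fin n} (h : j.val = i.val + 1) (hj : j.val + 1 = n) (f : Poly n) :
    refl i (refl j (refl i (refl j f))) = refl j (refl i (refl j (refl i f))) := by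
  have : (refl i).comp ((refl j).comp ((refl i).comp (refl j)))
      = (refl j : Poly n →ₐ[ℚ] Poly n).comp ((refl i).comp ((refl j).comp (refl i))) := by
    have xii := sX_self h
    have xij := sX_succ h
    have xji : sX j i = MvPolynomial.X i := sX_of_ne (by rintro rfl; omega) (by omega)
    have xjj := sX_last_self hj
    refine Poly.algHom_ext (fun l => ?_) fun l => ?_
    · simp only [AlgHom.comp_apply, refl_px, refl_ofPoly]
      refine congrArg ofPoly ?_
      obtain rfl | hi := eq_or_ne l i
      · simp only [xii, xij, xji, xjj, polyRefl_X, map_neg]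
      obtain rfl | hj' := eq_or_ne l j
      · simp only [xii, xij, xji, xjj, polyRefl_X, map_neg]
      have h1 := sX_of_ne hi fun e => hj' (Fin.ext (e.trans h.symm))
      have h2 : sX j l = MvPolynomial.X l := sX_of_ne hj' (by omega)
      simp only [h1, h2, polyRefl_X]
    · simp only [AlgHom.comp_apply, refl_pom]
      have oii := sOm_self h
      have oij : sOm i j = pom j := sOm_of_ne (by rintro rfl; omega)
      have oj := sOm_last hj
      obtain rfl | hi := eq_or_ne l i
      · simp only [oii, oij, oj, map_add, refl_smul, refl_pom, map_sub, map_pow,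
          polyRefl_X, xii, xij, xji, xjj, map_neg]
        module
      simp only [sOm_of_ne hi, oj, refl_pom]
  exact DFunLike.congr_fun this f

/-! ### Commutation, braid and Leibniz relations for the Demazure operators. -/

theorem demazure_comm {i j : Fin n} (h : i.val + 1 < j.val) (f : Poly n) :
    demazure i (demazure j f) = demazure j (demazure i f) := by
  refine (isDividedDifference_demazure i).comm (isDividedDifference_demazure j) ?_ ?_
    (refl_comm h) f
  · change polyRefl i (rootPoly j) = rootPoly j
    obtain ⟨k, hk⟩ | hj := exists_succ_or_last j
    · rw [rootPoly_eq hk, map_sub, polyRefl_X, polyRefl_X, sX_of_ne (by rintro rfl; omega) (by omega),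
        sX_of_ne (by rintro rfl; omega) (by omega)]
    · rw [rootPoly_last hj, map_mul, map_ofNat, polyRefl_X,
        sX_of_ne (by rintro rfl; omega) (by omega)]
  · change polyRefl j (rootPoly i) = rootPoly i
    obtain ⟨k, hk⟩ : ∃ k : Fin n, k.val = i.val + 1 := ⟨⟨i.val + 1, by omega⟩, rfl⟩
    rw [rootPoly_eq hk, map_sub, polyRefl_X, polyRefl_X, sX_of_ne (by rintro rfl; omega) (by omega),
        sX_of_ne (by rintro rfl; omega) (by omega)]

theorem X_sub_X_ne_zero {i j : Fin n} (h : i ≠ j) :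
    (MvPolynomial.X i - MvPolynomial.X j : MvPolynomial (Fin n) ℚ) ≠ 0 :=
  sub_ne_zero.2 fun e => h (MvPolynomial.X_injective e)

theorem X_add_X_ne_zero (i j : Fin n) :
    (MvPolynomial.X i + MvPolynomial.X j : MvPolynomial (Fin n) ℚ) ≠ 0 := by
  intro e
  have := congrArg (MvPolynomial.eval fun _ => (1 : ℚ)) e
  norm_num at this

theorem demazure_braid {i j : Fin n} (h : j.val = i.val + 1) (hj : j.val + 1 < n) (f : Poly n) :
    demazure i (demazure j (demazure i f)) = demazure j (demazure i (demazure j f)) := by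
  obtain ⟨k, hk⟩ : ∃ k : Fin n, k.val = j.val + 1 := ⟨⟨j.val + 1, hj⟩, rfl⟩
  have hik : i ≠ k := by rintro rfl; omega
  refine (isDividedDifference_demazure i).braid (isDividedDifference_demazure j) ?_ ?_
    (refl_braid h hj) (fun m m' => poly_smul_cancel ?_) f
  · change polyRefl i (rootPoly j) = rootPoly i + rootPoly j
    rw [rootPoly_eq h, rootPoly_eq hk, map_sub, polyRefl_X, polyRefl_X, sX_succ h,
      sX_of_ne hik.symm (by omega)]
    ring
  · change polyRefl j (rootPoly i) = rootPoly i + rootPoly j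
    rw [rootPoly_eq h, rootPoly_eq hk, map_sub, polyRefl_X, polyRefl_X, sX_self hk,
      sX_of_ne (by rintro rfl; omega) (by omega)]
    ring
  · rw [rootPoly_eq h, rootPoly_eq hk, sub_add_sub_cancel]
    exact X_sub_X_ne_zero hik

theorem demazure_braid_last {i j : Fin n} (h : j.val = i.val + 1) (hj : j.val + 1 = n)
    (f : Poly n) : demazure i (demazure j (demazure i (demazure j f)))
      = demazure j (demazure i (demazure j (demazure i f))) := by
  -- The roots here are `x_i - x_n` and `2 x_n`. The other two positive roots are `2 x_i` and `x_i +
  -- x_n`, and writing the former as a sum lets one nonvanishing lemma serve both.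
  have e : rootPoly j + 2 * rootPoly i = MvPolynomial.X i + MvPolynomial.X i := by
    rw [rootPoly_eq h, rootPoly_last hj]; ring
  have e' : rootPoly i + rootPoly j = MvPolynomial.X i + MvPolynomial.X j := by
    rw [rootPoly_eq h, rootPoly_last hj]; ring
  refine (isDividedDifference_demazure i).braid_four (isDividedDifference_demazure j) ?_ ?_
    (refl_braid_last h hj) (fun m m' => poly_smul_cancel (e' ▸ X_add_X_ne_zero i j))
    (fun m m' => poly_smul_cancel (e ▸ X_add_X_ne_zero i i)) f
  · change polyRefl i (rootPoly j) = _
    rw [e, rootPoly_last hj, map_mul, map_ofNat, polyRefl_X, sX_succ h]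
    ring
  · change polyRefl j (rootPoly i) = _
    rw [e', rootPoly_eq h, map_sub, polyRefl_X, polyRefl_X, sX_last_self hj,
      sX_of_ne (by rintro rfl; omega) (by omega)]
    ring

/-- The twisted Leibniz rule. -/
theorem demazure_mul (i : Fin n) (f g : Poly n) :
    demazure i (f * g) = demazure i f * g + refl i f * demazure i g := by
  refine root_mul_cancel i ?_
  have hc : Commute (root i) (refl i f) := root_eq i ▸ comm_left _ _
  rw [root_mul_demazure, mul_add, ← mul_assoc, ← mul_assoc, hc.eq, mul_assoc (refl i f),
    root_mul_demazure, root_mul_demazure, map_mul]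
  noncomm_ring

theorem demazure_eq_zero {i : Fin n} {f : Poly n} (h : refl i f = f) : demazure i f = 0 :=
  root_mul_cancel i (by rw [root_mul_demazure, h, sub_self, mul_zero])

/-- Every relation saying that some element commutes with `∂_i` is obtained from this linearity over
`s_i`-invariants. -/
theorem demazure_mul_of_refl_eq {i : Fin n} {f : Poly n} (h : refl i f = f) (g : Poly n) :
    demazure i (f * g) = f * demazure i g := by
  rw [demazure_mul, demazure_eq_zero h, h, zero_mul, zero_add]

theorem demazure_px_self (i : Fin n) : demazure i (px i) = 1 :=
  root_mul_cancel i (by rw [root_mul_demazure, mul_one, root])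

theorem demazure_px_succ {i j : Fin n} (h : j.val = i.val + 1) : demazure i (px j) = -1 := by
  refine root_mul_cancel i ?_
  rw [root_mul_demazure, mul_neg_one, root, refl_px, refl_px, sX_self h, sX_succ h, neg_sub]
  rfl

end Reflections

/-! ### The action on extended polynomials -/

section Action

variable (n : ℕ)

/-- The operators on extended polynomials by which the generators act. -/
noncomputable def opEnd : ExtGen n → Module.End ℚ (Poly n)
  | .x i => LinearMap.mulLeft ℚ (px i)
  | .d i => demazure i
  | .om i => LinearMap.mulLeft ℚ (pom i)

theorem lift_opEnd_nhRel {a b : FreeAlgebra ℚ (NHGen n)} (h : NHRel n a b) :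
    FreeAlgebra.lift ℚ (opEnd n) (freeIncl n a) = FreeAlgebra.lift ℚ (opEnd n) (freeIncl n b) := by
  cases h <;> refine LinearMap.ext fun f => ?_ <;>
    simp only [fX, fD, freeIncl, map_mul, map_zero, map_one, map_neg, map_sub, map_add,
      FreeAlgebra.lift_ι_apply, NHGen.toExt, opEnd, Module.End.mul_apply, LinearMap.zero_apply,
      LinearMap.sub_apply, LinearMap.add_apply, LinearMap.neg_apply, Module.End.one_apply,
      LinearMap.mulLeft_apply]
  case x_comm i j => rw [← mul_assoc, ← mul_assoc, (px_comm i _).eq]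
  case d_sq i => exact (isDividedDifference_demazure i).apply_apply f
  case d_comm i j h =>
    obtain h | h := h
    · exact demazure_comm h f
    · exact (demazure_comm h f).symm
  case d_braid i j h hj => exact demazure_braid h hj f
  case d_braid_last i j h hj => exact demazure_braid_last h hj f
  case d_x_comm i j h h' =>
    exact demazure_mul_of_refl_eq (by rw [refl_px, sX_of_ne h h']; rfl) f
  case d_x i j h =>
    rw [demazure_mul, demazure_px_self, refl_px, sX_self h, one_mul]
    exact add_sub_cancel_right _ _
  case d_x_succ i j h =>
    rw [demazure_mul, demazure_px_succ h, refl_px, sX_succ h, neg_one_mul]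
    exact add_sub_cancel_right _ _
  case d_x_last i h =>
    rw [demazure_mul, demazure_px_self, refl_px, sX_last_self h, one_mul, map_neg, neg_mul]
    exact neg_add_cancel_right _ _

theorem lift_opEnd_smashRel {a b : FreeAlgebra ℚ (ExtGen n)} (h : SmashRel n a b) :
    FreeAlgebra.lift ℚ (opEnd n) a = FreeAlgebra.lift ℚ (opEnd n) b := by
  cases h
  case nh a b h => exact lift_opEnd_nhRel n h
  all_goals
    refine LinearMap.ext fun f => ?_
    simp only [eX, eD, eOm, map_mul, map_zero, map_neg, map_sub, map_pow,
      FreeAlgebra.lift_ι_apply, opEnd, Module.End.mul_apply, LinearMap.zero_apply,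
      LinearMap.sub_apply, LinearMap.neg_apply, LinearMap.mulLeft_apply]
  case om_sq i =>
    have h : pom i * pom i = 0 := by
      have h2 : (2 : ℚ) • (pom i * pom i) = 0 := by
        rw [two_smul]; nth_rewrite 1 [pom_mul]; exact neg_add_cancel _
      exact (smul_eq_zero.1 h2).resolve_left two_ne_zero
    rw [← mul_assoc, h, zero_mul]
  case om_anti i j => rw [← mul_assoc, pom_mul, neg_mul, mul_assoc]
  case x_om i j => rw [← mul_assoc, ← mul_assoc, (px_comm i _).eq]
  case d_om i j h =>
    exact demazure_mul_of_refl_eq (by rw [refl_pom, sOm_of_ne h.symm]) f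
  case d_om_shift i j h =>
    have hj : j ≠ i := by rintro rfl; omega
    have e : ∀ g : Poly n, pom i * g - ((LinearMap.mulLeft ℚ (px j)) ^ 2) (pom j * g)
        = (pom i - px j ^ 2 * pom j) * g := by
      intro g
      rw [sq, Module.End.mul_apply, LinearMap.mulLeft_apply, LinearMap.mulLeft_apply, sub_mul, sq]
      simp only [mul_assoc]
    rw [← map_sub (demazure i), e, e]
    -- Invariance holds because `s_i` adds `(x_i² - x_{i+1}²) ω_{i+1}` to `ω_i` and replaces
    -- `x_{i+1}² ω_{i+1}` by `x_i² ω_{i+1}`.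
    refine demazure_mul_of_refl_eq ?_ f
    rw [map_sub, map_mul, map_pow, refl_px, refl_pom, refl_pom, sOm_self h, sX_succ h,
      sOm_of_ne hj, poly_smul_def, map_sub, map_pow, map_pow, px]
    noncomm_ring
  case d_om_last i j h => exact demazure_mul_of_refl_eq (by rw [refl_pom, sOm_last h]) f

/-- The action of the smash product on extended polynomials. -/
noncomputable def smashAct : Smash n →ₐ[ℚ] Module.End ℚ (Poly n) :=
  RingQuot.liftAlgHom ℚ ⟨FreeAlgebra.lift ℚ (opEnd n), fun _ _ h => lift_opEnd_smashRel n h⟩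

theorem smashAct_smashGen (g : ExtGen n) : smashAct n (smashGen n g) = opEnd n g := by
  rw [smashAct, smashGen, RingQuot.liftAlgHom_mkAlgHom_apply, FreeAlgebra.lift_ι_apply]

end Action

/-! ### Spanning the nilHecke algebra over the polynomials -/

/-- A subspace stable under left multiplication by generators is a left ideal, and it contains `1`.
All later spanning statements, and proofs that a linear condition holds for every element, go
through this principle. -/
theorem ringQuot_eq_top_of_left_mul_mem {X : Type*} {r : FreeAlgebra ℚ X → FreeAlgebra ℚ X → Prop}
    {V : Submodule ℚ (RingQuot r)} (one : 1 ∈ V)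
    (mul : ∀ g, ∀ v ∈ V, RingQuot.mkAlgHom ℚ r (FreeAlgebra.ι ℚ g) * v ∈ V) : V = ⊤ := by
  have key : ∀ a : FreeAlgebra ℚ X, ∀ v ∈ V, RingQuot.mkAlgHom ℚ r a * v ∈ V := by
    intro a
    induction a using FreeAlgebra.induction with
    | grade0 c =>
      intro v hv
      rw [AlgHom.commutes, ← Algebra.smul_def]
      exact V.smul_mem _ hv
    | grade1 g => exact mul g
    | mul a b ha hb =>
      intro v hv
      rw [map_mul, mul_assoc]
      exact ha _ (hb v hv)
    | add a b ha hb =>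
      intro v hv
      rw [map_add, add_mul]
      exact V.add_mem (ha v hv) (hb v hv)
  refine (Submodule.eq_top_iff').2 fun a => ?_
  obtain ⟨a, rfl⟩ := RingQuot.mkAlgHom_surjective ℚ r a
  simpa using key a 1 one

section NilHecke

variable {n : ℕ}

/-- The generator `x_i` of the nilHecke algebra. -/
noncomputable def nhX (i : Fin n) : NH n := RingQuot.mkAlgHom ℚ (NHRel n) (fX i)

/-- The generator `∂_i` of the nilHecke algebra. -/
noncomputable def nhD (i : Fin n) : NH n := RingQuot.mkAlgHom ℚ (NHRel n) (fD i)

theorem NH.eq_top_of_left_mul_mem {V : Submodule ℚ (NH n)} (one : 1 ∈ V)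
    (mul_x : ∀ i, ∀ v ∈ V, nhX i * v ∈ V) (mul_d : ∀ i, ∀ v ∈ V, nhD i * v ∈ V) : V = ⊤ :=
  ringQuot_eq_top_of_left_mul_mem one fun g => by
    cases g with
    | x i => exact mul_x i
    | d i => exact mul_d i

theorem nhX_comm (i j : Fin n) : nhX i * nhX j = nhX j * nhX i := by
  simp only [nhX, ← map_mul]
  exact RingQuot.mkAlgHom_rel ℚ (NHRel.x_comm i j)

open scoped IsMulCommutative in
-- The target is noncommutative, so evaluation of polynomials takes place in the commutative
-- subalgebra generated by the `x_i`.
theorem exists_polyToNH (n : ℕ) :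
    ∃ c : MvPolynomial (Fin n) ℚ →ₐ[ℚ] NH n, ∀ i, c (MvPolynomial.X i) = nhX i := by
  have := Algebra.isMulCommutative_adjoin ℚ (s := Set.range (nhX (n := n)))
    (by rintro _ ⟨i, rfl⟩ _ ⟨j, rfl⟩; exact nhX_comm i j)
  refine ⟨(Algebra.adjoin ℚ (Set.range (nhX (n := n)))).val.comp
    (MvPolynomial.aeval fun i => ⟨nhX i, Algebra.subset_adjoin ⟨i, rfl⟩⟩), fun i => ?_⟩
  rw [AlgHom.comp_apply, MvPolynomial.aeval_X]
  rfl

/-- The canonical map from the polynomials to the nilHecke algebra. -/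
noncomputable def polyToNH : MvPolynomial (Fin n) ℚ →ₐ[ℚ] NH n := (exists_polyToNH n).choose

theorem polyToNH_X (i : Fin n) : polyToNH (MvPolynomial.X i) = nhX i :=
  (exists_polyToNH n).choose_spec i

theorem exists_nhD_mul_nhX (i j : Fin n) :
    ∃ q, nhD i * nhX j = polyToNH (sX i j) * nhD i + polyToNH q := by
  by_cases hij : j = i
  · subst hij
    obtain ⟨k, h⟩ | h := exists_succ_or_last j
    · refine ⟨1, ?_⟩
      have e := RingQuot.mkAlgHom_rel ℚ (NHRel.d_x j k h)
      simp only [map_sub, map_mul, map_one] at e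
      rw [sX_self h, polyToNH_X, map_one]
      exact eq_add_of_sub_eq' e
    · refine ⟨1, ?_⟩
      have e := RingQuot.mkAlgHom_rel ℚ (NHRel.d_x_last j h)
      simp only [map_add, map_mul, map_one] at e
      rw [sX_last_self h, map_neg, polyToNH_X, map_one]
      refine (eq_sub_of_add_eq e).trans ?_
      have g : ∀ {R : Type} [Ring R] (a b : R), 1 - a * b = -a * b + 1 := by
        intros; noncomm_ring
      exact g _ _
  by_cases h : j.val = i.val + 1
  · refine ⟨-1, ?_⟩
    have e := RingQuot.mkAlgHom_rel ℚ (NHRel.d_x_succ i j h)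
    simp only [map_sub, map_mul, map_one, map_neg] at e
    rw [sX_succ h, polyToNH_X, map_neg, map_one]
    exact eq_add_of_sub_eq' e
  · refine ⟨0, ?_⟩
    have e := RingQuot.mkAlgHom_rel ℚ (NHRel.d_x_comm i j hij h)
    simp only [map_mul] at e
    rw [sX_of_ne hij h, polyToNH_X, map_zero, add_zero]
    exact e

/-- The straightening rule is derived from the relations alone, by induction on `p`. Only the
existence of the remainder `q` is needed, not its value. -/
theorem exists_nhD_mul_polyToNH (i : Fin n) (p : MvPolynomial (Fin n) ℚ) :
    ∃ q, nhD i * polyToNH p = polyToNH (polyRefl i p) * nhD i + polyToNH q := by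
  induction p using MvPolynomial.induction_on with
  | C a =>
    refine ⟨0, ?_⟩
    rw [← MvPolynomial.algebraMap_eq, AlgHom.commutes, AlgHom.commutes, AlgHom.commutes, map_zero,
      add_zero, Algebra.commutes]
  | add p q hp hq =>
    obtain ⟨p', hp⟩ := hp
    obtain ⟨q', hq⟩ := hq
    refine ⟨p' + q', ?_⟩
    simp only [map_add, mul_add, add_mul, hp, hq]
    abel
  | mul_X p j hp =>
    obtain ⟨p', hp⟩ := hp
    obtain ⟨q, hq⟩ := exists_nhD_mul_nhX i j
    refine ⟨polyRefl i p * q + p' * MvPolynomial.X j, ?_⟩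
    rw [map_mul, polyToNH_X, ← mul_assoc, hp, add_mul, mul_assoc, hq]
    simp only [map_add, map_mul, polyRefl_X, polyToNH_X, mul_add]
    simp only [mul_assoc, add_assoc]

/-- The generators `∂_i` numbered from the last one, continued by zero. -/
noncomputable def revD (n k : ℕ) : NH n :=
  if h : k < n then nhD ⟨n - 1 - k, by omega⟩ else 0

/-- Reversing the numbering puts the special node at `0`, where the induction on rank begins. Beyond
the range both sides of each relation contain a zero factor. -/
theorem isNilCoxeterB_revD (n : ℕ) : IsNilCoxeterB (revD n) where
  sq k := by
    rw [revD]
    split_ifs with h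
    · have e := RingQuot.mkAlgHom_rel ℚ (NHRel.d_sq (n := n) ⟨n - 1 - k, by omega⟩)
      simpa only [map_mul, map_zero] using! e
    · exact mul_zero _
  comm k l h := by
    by_cases hl : l < n
    · rw [revD, revD, dif_pos hl, dif_pos (by omega)]
      simpa only [map_mul] using! RingQuot.mkAlgHom_rel ℚ
        (NHRel.d_comm (n := n) ⟨n - 1 - k, by omega⟩ ⟨n - 1 - l, by omega⟩
          (Or.inr (by simp only; omega)))
    · simp [revD, hl]
  braid k := by
    by_cases hk : k + 2 < n
    · rw [revD, revD, dif_pos hk, dif_pos (by omega)]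
      simpa only [map_mul] using! (RingQuot.mkAlgHom_rel ℚ
        (NHRel.d_braid (n := n) ⟨n - 1 - (k + 2), by omega⟩ ⟨n - 1 - (k + 1), by omega⟩
          (by simp only; omega) (by simp only; omega))).symm
    · simp [revD, hk]
  braid_zero := by
    by_cases hk : 1 < n
    · rw [revD, revD, dif_pos hk, dif_pos (by omega)]
      simpa only [map_mul] using! RingQuot.mkAlgHom_rel ℚ
        (NHRel.d_braid_last (n := n) ⟨n - 1 - 1, by omega⟩ ⟨n - 1 - 0, by omega⟩
          (by simp only; omega) (by simp only; omega))
    · simp [revD, hk]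

theorem nhD_mem_adjoin (i : Fin n) : nhD i ∈ Algebra.adjoin ℚ (Set.range (revD n)) := by
  refine Algebra.subset_adjoin ⟨n - 1 - i, ?_⟩
  rw [revD, dif_pos (by omega)]
  exact congrArg nhD (Fin.ext (by simp only; omega))

/-- Index type of the standard basis of the nilHecke algebra over the polynomials. -/
abbrev WordIndex (n : ℕ) : Type := Fin (standardWords (revD n) n).length

/-- The standard basis of the nilHecke algebra as a left module over the polynomials. -/
noncomputable def nhWord (t : WordIndex n) : NH n := (standardWords (revD n) n).get t

/-- Linear combinations of the standard basis with polynomial coefficients. -/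
noncomputable def nhSum : (WordIndex n → MvPolynomial (Fin n) ℚ) →ₗ[ℚ] NH n where
  toFun p := ∑ t, polyToNH (p t) * nhWord t
  map_add' p q := by
    simp only [Pi.add_apply, map_add, add_mul, Finset.sum_add_distrib]
  map_smul' r p := by
    simp only [Pi.smul_apply, map_smul, smul_mul_assoc, Finset.smul_sum, RingHom.id_apply]

theorem nhSum_apply (p : WordIndex n → MvPolynomial (Fin n) ℚ) :
    nhSum p = ∑ t, polyToNH (p t) * nhWord t := rfl

theorem polyToNH_mul_mem_range {v : NH n} (q : MvPolynomial (Fin n) ℚ)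
    (hv : v ∈ LinearMap.range (nhSum (n := n))) : polyToNH q * v ∈ LinearMap.range (nhSum (n := n)) := by
  obtain ⟨p, rfl⟩ := hv
  refine ⟨q • p, ?_⟩
  simp only [nhSum_apply, Finset.mul_sum, Pi.smul_apply, smul_eq_mul, map_mul, mul_assoc]

theorem nhWord_mem_range (t : WordIndex n) : nhWord t ∈ LinearMap.range (nhSum (n := n)) := by
  refine ⟨Pi.single t 1, ?_⟩
  rw [nhSum_apply, Finset.sum_eq_single t]
  · rw [Pi.single_eq_same, map_one, one_mul]
  · intro s _ hs
    rw [Pi.single_eq_of_ne hs, map_zero, zero_mul]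
  · exact fun h => absurd (Finset.mem_univ t) h

theorem adjoin_revD_le_range :
    Subalgebra.toSubmodule (Algebra.adjoin ℚ (Set.range (revD n)))
      ≤ LinearMap.range (nhSum (n := n)) := by
  have h0 : ∀ i, n ≤ i → revD n i = 0 := fun i hi => by rw [revD, dif_neg (not_lt.2 hi)]
  rw [← (isNilCoxeterB_revD n).span_standardWords h0, Submodule.span_le]
  intro w hw
  obtain ⟨t, rfl⟩ := List.get_of_mem hw
  exact nhWord_mem_range t

/-- For a word `w`, straightening gives `∂_i p w = s_i(p) ∂_i w + q w`. Here `∂_i w` lies in the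
subalgebra generated by the `∂`'s, which the standard words span. -/
theorem nhSum_surjective : Function.Surjective (nhSum (n := n)) := by
  rw [← LinearMap.range_eq_top]
  refine NH.eq_top_of_left_mul_mem (adjoin_revD_le_range (one_mem (Algebra.adjoin ℚ (Set.range (revD n))))) ?_ ?_
  · intro i v hv
    rw [← polyToNH_X]
    exact polyToNH_mul_mem_range _ hv
  · rintro i _ ⟨p, rfl⟩
    rw [nhSum_apply, Finset.mul_sum]
    refine Submodule.sum_mem _ fun t _ => ?_
    obtain ⟨q, hq⟩ := exists_nhD_mul_polyToNH i (p t)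
    rw [← mul_assoc, hq, add_mul, mul_assoc]
    refine Submodule.add_mem _ (polyToNH_mul_mem_range _ (adjoin_revD_le_range ?_))
      (polyToNH_mul_mem_range _ (nhWord_mem_range t))
    exact (Algebra.adjoin ℚ (Set.range (revD n))).mul_mem (nhD_mem_adjoin i)
      (standardWords_mem_adjoin _ _ (List.get_mem _ _))

/-! ### Faithfulness of the action on polynomials -/

/-- The projection of the extended polynomials to the polynomials, killing the `ω_i`. -/
noncomputable def augmentation : Poly n →ₐ[ℚ] MvPolynomial (Fin n) ℚ :=
  (Algebra.TensorProduct.lift (AlgHom.id ℚ _)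
    ((Algebra.ofId ℚ _).comp ExteriorAlgebra.algebraMapInv) (fun _ _ => Commute.all _ _) :
      MvPolynomial (Fin n) ℚ ⊗[ℚ] Ext n →ₐ[ℚ] MvPolynomial (Fin n) ℚ)

theorem augmentation_ofPoly (p : MvPolynomial (Fin n) ℚ) : augmentation (ofPoly p) = p :=
  (Algebra.TensorProduct.lift_tmul _ _ _ _ _).trans (by simp)

theorem nhToSmash_mkAlgHom (a : FreeAlgebra ℚ (NHGen n)) :
    nhToSmash n (RingQuot.mkAlgHom ℚ (NHRel n) a)
      = RingQuot.mkAlgHom ℚ (SmashRel n) (freeIncl n a) :=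
  RingQuot.liftAlgHom_mkAlgHom_apply _ _ _ _

theorem nhToSmash_nhX (i : Fin n) : nhToSmash n (nhX i) = smashGen n (.x i) := by
  rw [nhX, nhToSmash_mkAlgHom, freeIncl, FreeAlgebra.lift_ι_apply]
  rfl

theorem nhToSmash_nhD (i : Fin n) : nhToSmash n (nhD i) = smashGen n (.d i) := by
  rw [nhD, nhToSmash_mkAlgHom, freeIncl, FreeAlgebra.lift_ι_apply]
  rfl

/-- The action of the nilHecke algebra on extended polynomials. -/
noncomputable def nhAct (n : ℕ) : NH n →ₐ[ℚ] Module.End ℚ (Poly n) :=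
  (smashAct n).comp (nhToSmash n)

theorem nhAct_nhD (i : Fin n) : nhAct n (nhD i) = demazure i := by
  rw [nhAct, AlgHom.comp_apply, nhToSmash_nhD, smashAct_smashGen]; rfl

theorem nhAct_polyToNH (p : MvPolynomial (Fin n) ℚ) (f : Poly n) :
    nhAct n (polyToNH p) f = ofPoly p * f := by
  have : (nhAct n).comp polyToNH = (Algebra.lmul ℚ (Poly n)).comp ofPoly := by
    refine MvPolynomial.algHom_ext fun i => ?_
    rw [AlgHom.comp_apply, polyToNH_X, nhAct, AlgHom.comp_apply, nhToSmash_nhX, smashAct_smashGen]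
    rfl
  exact DFunLike.congr_fun (DFunLike.congr_fun this p) f

/-- Applying the augmentation to the defining equation of `∂_i p` shows that its polynomial part
solves the same equation, whose solution is unique. -/
theorem demazure_ofPoly (i : Fin n) (p : MvPolynomial (Fin n) ℚ) :
    demazure i (ofPoly p) = ofPoly (augmentation (demazure i (ofPoly p))) := by
  refine root_mul_cancel i ?_
  have h := root_mul_demazure i (ofPoly p)
  rw [refl_ofPoly, ← map_sub] at h
  have h' := congrArg augmentation h
  rw [root_eq, map_mul, augmentation_ofPoly, augmentation_ofPoly] at h'
  rw [h, root_eq, ← map_mul, h']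

theorem nhAct_ofPoly (h : NH n) (p : MvPolynomial (Fin n) ℚ) :
    nhAct n h (ofPoly p) = ofPoly (augmentation (nhAct n h (ofPoly p))) := by
  let V : Submodule ℚ (NH n) :=
    { carrier := {h | ∀ p, nhAct n h (ofPoly p) = ofPoly (augmentation (nhAct n h (ofPoly p)))}
      zero_mem' := fun p => by simp
      add_mem' := fun {a b} ha hb p => by
        rw [map_add, LinearMap.add_apply, map_add, map_add, ← ha, ← hb]
      smul_mem' := fun r a ha p => by
        rw [map_smul, LinearMap.smul_apply, map_smul, map_smul, ← ha] }
  suffices hV : V = ⊤ from (hV ▸ Submodule.mem_top : h ∈ V) p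
  refine NH.eq_top_of_left_mul_mem (fun p => ?_) (fun i v hv p => ?_) (fun i v hv p => ?_)
  · rw [map_one, Module.End.one_apply, augmentation_ofPoly]
  · rw [map_mul, Module.End.mul_apply, hv p, ← polyToNH_X, nhAct_polyToNH, ← map_mul,
      augmentation_ofPoly]
  · rw [map_mul, Module.End.mul_apply, hv p, nhAct_nhD]
    exact demazure_ofPoly i _

/-- The algebra endomorphisms of the polynomials by which elements of the nilHecke algebra act. -/
def actingAlgHoms (n : ℕ) : Submonoid (MvPolynomial (Fin n) ℚ →ₐ[ℚ] MvPolynomial (Fin n) ℚ) where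
  carrier := {θ | ∃ h, ∀ p, nhAct n h (ofPoly p) = ofPoly (θ p)}
  one_mem' := ⟨1, fun p => by rw [map_one]; rfl⟩
  mul_mem' := by
    rintro θ η ⟨h, hh⟩ ⟨k, hk⟩
    refine ⟨h * k, fun p => ?_⟩
    rw [map_mul, Module.End.mul_apply, hk, hh]
    rfl

/-- This is the definition of `∂_i` solved for `s_i`. -/
theorem polyRefl_mem_actingAlgHoms (i : Fin n) : polyRefl i ∈ actingAlgHoms n := by
  refine ⟨1 - polyToNH (rootPoly i) * nhD i, fun p => ?_⟩
  rw [map_sub, map_one, map_mul, nhAct_nhD, LinearMap.sub_apply, Module.End.mul_apply,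
    nhAct_polyToNH, Module.End.one_apply, rootPoly, ← root_eq, root_mul_demazure, sub_sub_cancel,
    refl_ofPoly]

/-- The automorphism `x_j ↦ ε_j x_{σ(j)}` of the polynomials. -/
noncomputable def signedPerm (σ : Equiv.Perm (Fin n)) (ε : Fin n → ℤˣ) :
    MvPolynomial (Fin n) ℚ →ₐ[ℚ] MvPolynomial (Fin n) ℚ :=
  MvPolynomial.aeval fun j => ((ε j : ℤ) : MvPolynomial (Fin n) ℚ) * MvPolynomial.X (σ j)

theorem signedPerm_X (σ : Equiv.Perm (Fin n)) (ε : Fin n → ℤˣ) (j : Fin n) :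
    signedPerm σ ε (MvPolynomial.X j)
      = ((ε j : ℤ) : MvPolynomial (Fin n) ℚ) * MvPolynomial.X (σ j) :=
  MvPolynomial.aeval_X _ _

theorem signedPerm_mul (σ τ : Equiv.Perm (Fin n)) (ε η : Fin n → ℤˣ) :
    signedPerm σ ε * signedPerm τ η = signedPerm (σ * τ) fun j => η j * ε (τ j) := by
  refine MvPolynomial.algHom_ext fun j => ?_
  rw [AlgHom.mul_apply, signedPerm_X, map_mul, map_intCast, signedPerm_X, signedPerm_X,
    Units.val_mul, Int.cast_mul, mul_assoc]
  rfl

theorem signedPerm_one : signedPerm (1 : Equiv.Perm (Fin n)) 1 = 1 := by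
  refine MvPolynomial.algHom_ext fun j => ?_
  simp [signedPerm_X]

theorem signedPerm_perm_mem (σ : Equiv.Perm (Fin n)) : signedPerm σ 1 ∈ actingAlgHoms n := by
  let S : Submonoid (Equiv.Perm (Fin n)) :=
    { carrier := {σ | signedPerm σ 1 ∈ actingAlgHoms n}
      one_mem' := by
        rw [Set.mem_ofPred_eq, signedPerm_one]
        exact one_mem _
      mul_mem' := fun {σ τ} hσ hτ => by
        have := (actingAlgHoms n).mul_mem hσ hτ
        rwa [signedPerm_mul] at this }
  suffices hS : S = ⊤ from (hS ▸ Submonoid.mem_top σ : σ ∈ S)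
  cases n with
  | zero => exact (Submonoid.eq_top_iff' S).2 fun σ => Subsingleton.elim 1 σ ▸ one_mem S
  | succ n =>
    rw [← top_le_iff, ← Equiv.Perm.mclosure_swap_castSucc_succ, Submonoid.closure_le]
    rintro _ ⟨i, rfl⟩
    have h : i.succ.val = i.castSucc.val + 1 := by simp
    have e : signedPerm (Equiv.swap i.castSucc i.succ) 1 = polyRefl i.castSucc := by
      refine MvPolynomial.algHom_ext fun j => ?_
      rw [signedPerm_X, polyRefl_X, Pi.one_apply, Units.val_one, Int.cast_one, one_mul]
      obtain rfl | hj := eq_or_ne j i.castSucc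
      · rw [Equiv.swap_apply_left, sX_self h]
      obtain rfl | hj' := eq_or_ne j i.succ
      · rw [Equiv.swap_apply_right, sX_succ h]
      rw [Equiv.swap_apply_of_ne_of_ne hj hj', sX_of_ne hj fun e => hj' (Fin.ext (e.trans h.symm))]
    change signedPerm _ 1 ∈ actingAlgHoms (n + 1)
    rw [e]
    exact polyRefl_mem_actingAlgHoms _

/-- The sign change of the last variable is a simple reflection. Conjugating it by the transposition
of `j` with the last index moves it to `j`. -/
theorem signedPerm_mulSingle_mem (j : Fin n) :
    signedPerm 1 (Pi.mulSingle j (-1)) ∈ actingAlgHoms n := by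
  obtain ⟨l, hl⟩ : ∃ l : Fin n, l.val + 1 = n := ⟨⟨n - 1, by have := j.isLt; omega⟩, by have := j.isLt; simp only; omega⟩
  have e : signedPerm 1 (Pi.mulSingle l (-1)) = polyRefl l := by
    refine MvPolynomial.algHom_ext fun k => ?_
    rw [signedPerm_X, polyRefl_X, Equiv.Perm.one_apply]
    obtain rfl | hk := eq_or_ne k l
    · simp [sX_last_self hl]
    · rw [sX_of_ne hk (by omega), Pi.mulSingle_eq_of_ne hk]
      simp
  have h := mul_mem (mul_mem (signedPerm_perm_mem (Equiv.swap j l))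
    (e ▸ polyRefl_mem_actingAlgHoms l)) (signedPerm_perm_mem (Equiv.swap j l))
  rw [signedPerm_mul, signedPerm_mul, mul_one, Equiv.swap_mul_self] at h
  convert h using 2
  funext k
  have hk : Equiv.swap j l k = l ↔ k = j := by
    rw [← Equiv.eq_symm_apply, Equiv.symm_swap, Equiv.swap_apply_right]
  simp only [Pi.mulSingle_apply, hk, Pi.one_apply, mul_one, one_mul]

theorem signedPerm_mem (σ : Equiv.Perm (Fin n)) (ε : Fin n → ℤˣ) :
    signedPerm σ ε ∈ actingAlgHoms n := by
  let S : Submonoid (Fin n → ℤˣ) :=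
    { carrier := {ε | signedPerm 1 ε ∈ actingAlgHoms n}
      one_mem' := by
        rw [Set.mem_ofPred_eq, signedPerm_one]
        exact one_mem _
      mul_mem' := fun {ε η} hε hη => by
        -- The factors are taken in reverse order because the composition formula `signedPerm_mul`
        -- puts the signs of the second map first.
        have := (actingAlgHoms n).mul_mem hη hε
        rwa [signedPerm_mul] at this }
  have hS : ε ∈ S := by
    rw [← Finset.univ_prod_mulSingle ε]
    refine prod_mem fun j _ => ?_
    obtain h | h := Int.units_eq_one_or (ε j)
    · rw [h, Pi.mulSingle_one]; exact one_mem S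
    · rw [h]; exact signedPerm_mulSingle_mem j
  have := mul_mem (signedPerm_perm_mem σ) hS
  rw [signedPerm_mul] at this
  simpa using this

theorem signedPerm_injective :
    Function.Injective fun w : Equiv.Perm (Fin n) × (Fin n → ℤˣ) => signedPerm w.1 w.2 := by
  rintro ⟨σ, ε⟩ ⟨τ, η⟩ h
  have key : ∀ j, ε j = η j ∧ σ j = τ j := by
    intro j
    have e := DFunLike.congr_fun h (MvPolynomial.X j)
    dsimp only at e
    rw [signedPerm_X, signedPerm_X] at e
    -- Evaluation at the all-ones point forgets the permutation and isolates the sign.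
    have e' := congrArg (MvPolynomial.eval fun _ => (1 : ℚ)) e
    simp only [map_mul, map_intCast, MvPolynomial.eval_X, mul_one, Int.cast_inj, Units.val_inj]
      at e'
    refine ⟨e', ?_⟩
    rw [e'] at e
    have h0 : ((η j : ℤ) : MvPolynomial (Fin n) ℚ) ≠ 0 := Int.cast_ne_zero.2 (η j).ne_zero
    exact MvPolynomial.X_injective (mul_left_cancel₀ h0 e)
  exact Prod.ext (Equiv.ext fun j => (key j).2) (funext fun j => (key j).1)

/-- Elements of the nilHecke algebra as functions from polynomials to rational functions. -/
noncomputable def nhFun : NH n →+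
    (MvPolynomial (Fin n) ℚ → FractionRing (MvPolynomial (Fin n) ℚ)) where
  toFun h p := algebraMap _ _ (augmentation (nhAct n h (ofPoly p)))
  map_zero' := by
    funext p
    simp only [map_zero, LinearMap.zero_apply, Pi.zero_apply]
  map_add' h k := by
    funext p
    simp only [map_add, LinearMap.add_apply, Pi.add_apply]

theorem nhFun_apply (h : NH n) (p : MvPolynomial (Fin n) ℚ) :
    nhFun h p = algebraMap _ _ (augmentation (nhAct n h (ofPoly p))) := rfl

theorem nhFun_polyToNH_mul (p : MvPolynomial (Fin n) ℚ) (h : NH n) :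
    nhFun (polyToNH p * h)
      = algebraMap _ (FractionRing (MvPolynomial (Fin n) ℚ)) p • nhFun h := by
  funext q
  rw [Pi.smul_apply, nhFun_apply, nhFun_apply, map_mul, Module.End.mul_apply, nhAct_polyToNH,
    map_mul, augmentation_ofPoly, map_mul, smul_eq_mul]

theorem nhFun_nhSum (p : WordIndex n → MvPolynomial (Fin n) ℚ) :
    nhFun (nhSum p)
      = ∑ t, algebraMap _ (FractionRing (MvPolynomial (Fin n) ℚ)) (p t) • nhFun (nhWord t) := by
  rw [nhSum_apply, map_sum]
  exact Finset.sum_congr rfl fun t _ => nhFun_polyToNH_mul _ _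

theorem nhFun_mem_span (h : NH n) :
    nhFun h ∈ Submodule.span (FractionRing (MvPolynomial (Fin n) ℚ))
      (Set.range fun t : WordIndex n => nhFun (nhWord t)) := by
  obtain ⟨p, rfl⟩ := nhSum_surjective h
  rw [nhFun_nhSum]
  exact Submodule.sum_mem _ fun t _ => Submodule.smul_mem _ _ (Submodule.subset_span ⟨t, rfl⟩)

/-- A spanning family with no more members than the dimension of its span is independent. The lower
bound on that dimension comes from the signed permutations, which lie in the span and are
independent by Dedekind's lemma. -/
theorem linearIndependent_nhWord :
    LinearIndependent (FractionRing (MvPolynomial (Fin n) ℚ))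
      fun t : WordIndex n => nhFun (nhWord t) := by
  rw [linearIndependent_iff_card_le_finrank_span]
  let ψ : Equiv.Perm (Fin n) × (Fin n → ℤˣ) →
      (MvPolynomial (Fin n) ℚ →* FractionRing (MvPolynomial (Fin n) ℚ)) := fun w =>
    (algebraMap (MvPolynomial (Fin n) ℚ)
      (FractionRing (MvPolynomial (Fin n) ℚ))).toMonoidHom.comp
        (signedPerm w.1 w.2).toRingHom.toMonoidHom
  have hψ : Function.Injective ψ := by
    intro v w h
    refine signedPerm_injective (AlgHom.ext fun p => ?_)
    exact IsFractionRing.injective (MvPolynomial (Fin n) ℚ)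
      (FractionRing (MvPolynomial (Fin n) ℚ)) (DFunLike.congr_fun h p)
  have hli := (linearIndependent_monoidHom (MvPolynomial (Fin n) ℚ)
    (FractionRing (MvPolynomial (Fin n) ℚ))).comp ψ hψ
  have hcard := finrank_span_eq_card hli
  have hle : Submodule.span (FractionRing (MvPolynomial (Fin n) ℚ))
      (Set.range ((fun f : MvPolynomial (Fin n) ℚ →* FractionRing (MvPolynomial (Fin n) ℚ) =>
        (f : MvPolynomial (Fin n) ℚ → FractionRing (MvPolynomial (Fin n) ℚ))) ∘ ψ))
      ≤ Submodule.span _ (Set.range fun t : WordIndex n => nhFun (nhWord t)) := by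
    rw [Submodule.span_le]
    rintro _ ⟨w, rfl⟩
    obtain ⟨h, hh⟩ := signedPerm_mem w.1 w.2
    have e : nhFun h = ψ w := funext fun p => by
      rw [nhFun_apply, hh, augmentation_ofPoly]
      rfl
    exact (e ▸ nhFun_mem_span h : (ψ w : MvPolynomial (Fin n) ℚ → _) ∈ _)
  have hfin := FiniteDimensional.span_of_finite (FractionRing (MvPolynomial (Fin n) ℚ))
    (Set.finite_range fun t : WordIndex n => nhFun (nhWord t))
  refine le_trans (le_of_eq ?_) (Submodule.finrank_mono hle)
  -- Both families have `2 ^ n * n!` members.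
  rw [hcard, Fintype.card_fin, length_standardWords, Fintype.card_prod, Fintype.card_perm,
    Fintype.card_fin, Fintype.card_fun, Fintype.card_fin, Fintype.card_units_int, mul_comm]

/-- The nilHecke algebra acts faithfully on polynomials. -/
theorem eq_zero_of_nhAct_ofPoly {h : NH n} (hh : ∀ p, nhAct n h (ofPoly p) = 0) : h = 0 := by
  obtain ⟨p, rfl⟩ := nhSum_surjective h
  have h0 : nhFun (nhSum p) = 0 := by
    funext q
    rw [nhFun_apply, hh, map_zero, map_zero]; rfl
  rw [nhFun_nhSum] at h0
  have hp := Fintype.linearIndependent_iff.1 linearIndependent_nhWord _ h0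
  have : p = 0 := funext fun t =>
    IsFractionRing.injective (MvPolynomial (Fin n) ℚ) (FractionRing (MvPolynomial (Fin n) ℚ))
      ((hp t).trans (map_zero _).symm)
  rw [this, map_zero]

end NilHecke

/-! ### The smash product as a tensor product -/

section Smash

variable {n : ℕ}

theorem smash_mkAlgHom_eq {a b : FreeAlgebra ℚ (ExtGen n)} (h : SmashRel n a b) :
    RingQuot.mkAlgHom ℚ (SmashRel n) a = RingQuot.mkAlgHom ℚ (SmashRel n) b :=
  RingQuot.mkAlgHom_rel ℚ h

theorem smashGen_x_mul_om (i j : Fin n) :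
    smashGen n (.x i) * smashGen n (.om j) = smashGen n (.om j) * smashGen n (.x i) := by
  simpa only [map_mul] using! smash_mkAlgHom_eq (SmashRel.x_om i j)

theorem smashGen_d_mul_om {i j : Fin n} (h : i ≠ j) :
    smashGen n (.d i) * smashGen n (.om j) = smashGen n (.om j) * smashGen n (.d i) := by
  simpa only [map_mul] using! smash_mkAlgHom_eq (SmashRel.d_om i j h)

theorem smashGen_d_mul_om_last {i : Fin n} (j : Fin n) (h : i.val + 1 = n) :
    smashGen n (.d i) * smashGen n (.om j) = smashGen n (.om j) * smashGen n (.d i) := by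
  simpa only [map_mul] using! smash_mkAlgHom_eq (SmashRel.d_om_last i j h)

theorem smashGen_om_sq (i : Fin n) : smashGen n (.om i) * smashGen n (.om i) = 0 := by
  simpa only [map_mul, map_zero] using! smash_mkAlgHom_eq (SmashRel.om_sq i)

theorem smashGen_d_mul_shift {i j : Fin n} (h : j.val = i.val + 1) :
    smashGen n (.d i) * (smashGen n (.om i) - smashGen n (.x j) ^ 2 * smashGen n (.om j))
      = (smashGen n (.om i) - smashGen n (.x j) ^ 2 * smashGen n (.om j)) * smashGen n (.d i) := by
  simpa only [map_mul, map_sub, map_pow] using! smash_mkAlgHom_eq (SmashRel.d_om_shift i j h)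

/-- The shifted relation is solved so that each `ω` stands on the left. The price is a commutator of
`∂_i` with `x_{i+1}²`, which stays inside the nilHecke algebra. -/
theorem smashGen_d_mul_om_self {i j : Fin n} (h : j.val = i.val + 1) :
    smashGen n (.d i) * smashGen n (.om i)
      = smashGen n (.om i) * smashGen n (.d i)
        + smashGen n (.om j) * (smashGen n (.d i) * smashGen n (.x j) ^ 2
          - smashGen n (.x j) ^ 2 * smashGen n (.d i)) := by
  have hij : i ≠ j := by rintro rfl; omega
  have h1 := smashGen_d_mul_shift h
  have h2 : smashGen n (.x j) ^ 2 * smashGen n (.om j)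
      = smashGen n (.om j) * smashGen n (.x j) ^ 2 :=
    (show Commute _ _ from smashGen_x_mul_om j j).pow_left 2
  rw [h2, mul_sub, ← mul_assoc, smashGen_d_mul_om hij] at h1
  have g : ∀ {R : Type} [Ring R] {d a b y : R}, d * a - b * d * y = (a - b * y) * d →
      d * a = a * d + b * (d * y - y * d) := by
    intro R _ d a b y h
    rw [eq_add_of_sub_eq h]
    noncomm_ring
  exact g h1

theorem extToSmash_ι (v : Fin n → ℚ) :
    extToSmash n (ExteriorAlgebra.ι ℚ v) = ∑ j, v j • smashGen n (.om j) := by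
  rw [extToSmash, ExteriorAlgebra.lift_ι_apply, Fintype.linearCombination_apply]

theorem extToSmash_ι_single (j : Fin n) :
    extToSmash n (ExteriorAlgebra.ι ℚ (Pi.single j 1)) = smashGen n (.om j) := by
  rw [extToSmash, ExteriorAlgebra.lift_ι_apply, Fintype.linearCombination_apply_single, one_smul]

/-- Combinations of the `ω_j` with right coefficients in the nilHecke algebra. -/
noncomputable def omSum : (Fin n → NH n) →ₗ[ℚ] Smash n where
  toFun κ := ∑ j, smashGen n (.om j) * nhToSmash n (κ j)
  map_add' κ μ := by
    simp only [Pi.add_apply, map_add, mul_add, Finset.sum_add_distrib]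
  map_smul' r κ := by
    simp only [Pi.smul_apply, map_smul, mul_smul_comm, Finset.smul_sum, RingHom.id_apply]

theorem omSum_apply (κ : Fin n → NH n) :
    omSum κ = ∑ j, smashGen n (.om j) * nhToSmash n (κ j) := rfl

theorem om_mul_mem_range_omSum (j : Fin n) (h : NH n) :
    smashGen n (.om j) * nhToSmash n h ∈ LinearMap.range (omSum (n := n)) := by
  refine ⟨Pi.single j h, ?_⟩
  rw [omSum_apply, Finset.sum_eq_single j]
  · rw [Pi.single_eq_same]
  · intro k _ hk
    rw [Pi.single_eq_of_ne hk, map_zero, mul_zero]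
  · exact fun h => absurd (Finset.mem_univ j) h

theorem mul_mem_range_omSum {a : Smash n} (ha : a ∈ LinearMap.range (omSum (n := n))) (h : NH n) :
    a * nhToSmash n h ∈ LinearMap.range (omSum (n := n)) := by
  obtain ⟨κ, rfl⟩ := ha
  refine ⟨fun j => κ j * h, ?_⟩
  simp only [omSum_apply, Finset.sum_mul, map_mul, mul_assoc]

theorem left_mul_mem_range_omSum {b : Smash n}
    (hb : ∀ j, b * smashGen n (.om j) ∈ LinearMap.range (omSum (n := n))) {a : Smash n}
    (ha : a ∈ LinearMap.range (omSum (n := n))) : b * a ∈ LinearMap.range (omSum (n := n)) := by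
  obtain ⟨κ, rfl⟩ := ha
  rw [omSum_apply, Finset.mul_sum]
  refine Submodule.sum_mem _ fun j _ => ?_
  rw [← mul_assoc]
  exact mul_mem_range_omSum (hb j) _

theorem smashGen_x_mul_om_mem (i j : Fin n) :
    smashGen n (.x i) * smashGen n (.om j) ∈ LinearMap.range (omSum (n := n)) := by
  rw [smashGen_x_mul_om, ← nhToSmash_nhX]
  exact om_mul_mem_range_omSum _ _

theorem smashGen_d_mul_om_mem (i j : Fin n) :
    smashGen n (.d i) * smashGen n (.om j) ∈ LinearMap.range (omSum (n := n)) := by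
  obtain rfl | hij := eq_or_ne i j
  · obtain ⟨k, h⟩ | h := exists_succ_or_last i
    · rw [smashGen_d_mul_om_self h]
      simp only [← nhToSmash_nhD, ← nhToSmash_nhX, ← map_pow, ← map_mul, ← map_sub]
      exact Submodule.add_mem _ (om_mul_mem_range_omSum _ _) (om_mul_mem_range_omSum _ _)
    · rw [smashGen_d_mul_om_last _ h, ← nhToSmash_nhD]
      exact om_mul_mem_range_omSum _ _
  · rw [smashGen_d_mul_om hij, ← nhToSmash_nhD]
    exact om_mul_mem_range_omSum _ _

theorem nhToSmash_mul_om_mem (h : NH n) (j : Fin n) :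
    nhToSmash n h * smashGen n (.om j) ∈ LinearMap.range (omSum (n := n)) := by
  let V : Submodule ℚ (NH n) :=
    { carrier := {h | ∀ j, nhToSmash n h * smashGen n (.om j) ∈ LinearMap.range (omSum (n := n))}
      zero_mem' := fun j => by
        rw [map_zero, zero_mul]; exact Submodule.zero_mem _
      add_mem' := fun {a b} ha hb j => by
        rw [map_add, add_mul]; exact Submodule.add_mem _ (ha j) (hb j)
      smul_mem' := fun r a ha j => by
        rw [map_smul, smul_mul_assoc]; exact Submodule.smul_mem _ _ (ha j) }
  suffices hV : V = ⊤ from (hV ▸ Submodule.mem_top : h ∈ V) j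
  refine NH.eq_top_of_left_mul_mem (fun j => ?_) (fun i v hv j => ?_) (fun i v hv j => ?_)
  · rw [map_one, one_mul]
    simpa using om_mul_mem_range_omSum j 1
  · rw [map_mul, nhToSmash_nhX, mul_assoc]
    exact left_mul_mem_range_omSum (smashGen_x_mul_om_mem i) (hv j)
  · rw [map_mul, nhToSmash_nhD, mul_assoc]
    exact left_mul_mem_range_omSum (smashGen_d_mul_om_mem i) (hv j)

/-- The multiplication map `λ ⊗ h ↦ λ h`. -/
noncomputable def smashMulLeft (n : ℕ) : Ext n ⊗[ℚ] NH n →ₗ[ℚ] Smash n :=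
  TensorProduct.lift ((LinearMap.mul ℚ (Smash n)).compl₁₂ (extToSmash n).toLinearMap
    (nhToSmash n).toLinearMap)

theorem smashMulLeft_tmul (w : Ext n) (h : NH n) :
    smashMulLeft n (w ⊗ₜ h) = extToSmash n w * nhToSmash n h := rfl

theorem smashMul_tmul (h : NH n) (w : Ext n) :
    smashMul n (h ⊗ₜ w) = nhToSmash n h * extToSmash n w := rfl

theorem mul_nhToSmash_mem_range {a : Smash n} (ha : a ∈ LinearMap.range (smashMulLeft n))
    (h : NH n) : a * nhToSmash n h ∈ LinearMap.range (smashMulLeft n) := by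
  obtain ⟨z, rfl⟩ := ha
  induction z using TensorProduct.induction_on with
  | zero => rw [map_zero, zero_mul]; exact Submodule.zero_mem _
  | tmul w k => exact ⟨w ⊗ₜ (k * h), by rw [smashMulLeft_tmul, map_mul, ← mul_assoc]; rfl⟩
  | add x y hx hy => rw [map_add, add_mul]; exact Submodule.add_mem _ hx hy

theorem om_mul_mem_range {a : Smash n} (ha : a ∈ LinearMap.range (smashMulLeft n))
    (j : Fin n) : smashGen n (.om j) * a ∈ LinearMap.range (smashMulLeft n) := by
  obtain ⟨z, rfl⟩ := ha
  induction z using TensorProduct.induction_on with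
  | zero => rw [map_zero, mul_zero]; exact Submodule.zero_mem _
  | tmul w k =>
    refine ⟨(ExteriorAlgebra.ι ℚ (Pi.single j 1) * w) ⊗ₜ k, ?_⟩
    rw [smashMulLeft_tmul, map_mul, extToSmash_ι_single, mul_assoc]; rfl
  | add x y hx hy => rw [map_add, mul_add]; exact Submodule.add_mem _ hx hy

/-- One factor of `w` is moved past `h` at a time. Each passage replaces `h` by new coefficients `κ
j`, so the induction on `w` must keep `h` arbitrary. -/
theorem nhToSmash_mul_extToSmash_mem (h : NH n) (w : Ext n) :
    nhToSmash n h * extToSmash n w ∈ LinearMap.range (smashMulLeft n) := by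
  induction w using CliffordAlgebra.left_induction generalizing h with
  | algebraMap r =>
    refine ⟨algebraMap _ _ r ⊗ₜ h, ?_⟩
    rw [smashMulLeft_tmul, AlgHom.commutes, Algebra.commutes]
  | add x y hx hy =>
    rw [map_add, mul_add]
    exact Submodule.add_mem _ (hx h) (hy h)
  | ι_mul x v hx =>
    have hw : nhToSmash n h * extToSmash n (ExteriorAlgebra.ι ℚ v)
        ∈ LinearMap.range (omSum (n := n)) := by
      rw [extToSmash_ι, Finset.mul_sum]
      refine Submodule.sum_mem _ fun j _ => ?_
      rw [mul_smul_comm]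
      exact Submodule.smul_mem _ _ (nhToSmash_mul_om_mem h j)
    obtain ⟨κ, hκ⟩ := hw
    rw [map_mul, ← mul_assoc]
    change nhToSmash n h * extToSmash n (ExteriorAlgebra.ι ℚ v) * _ ∈ _
    rw [← hκ, omSum_apply, Finset.sum_mul]
    refine Submodule.sum_mem _ fun j _ => ?_
    rw [mul_assoc]
    exact om_mul_mem_range (hx _) j

theorem smashMulLeft_surjective : Function.Surjective (smashMulLeft n) := by
  rw [← LinearMap.range_eq_top]
  have key : ∀ (h : NH n), ∀ a ∈ LinearMap.range (smashMulLeft n),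
      nhToSmash n h * a ∈ LinearMap.range (smashMulLeft n) := by
    rintro h _ ⟨z, rfl⟩
    induction z using TensorProduct.induction_on with
    | zero => rw [map_zero, mul_zero]; exact Submodule.zero_mem _
    | tmul w k =>
      rw [smashMulLeft_tmul, ← mul_assoc]
      exact mul_nhToSmash_mem_range (nhToSmash_mul_extToSmash_mem h w) k
    | add x y hx hy => rw [map_add, mul_add]; exact Submodule.add_mem _ hx hy
  refine ringQuot_eq_top_of_left_mul_mem ⟨1 ⊗ₜ 1, ?_⟩ fun g a ha => ?_
  · rw [smashMulLeft_tmul, map_one, map_one, one_mul]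
  · cases g with
    | x i =>
      have := key (nhX i) a ha
      rwa [nhToSmash_nhX] at this
    | d i =>
      have := key (nhD i) a ha
      rwa [nhToSmash_nhD] at this
    | om i => exact om_mul_mem_range ha i

theorem smashAct_extToSmash (w : Ext n) (f : Poly n) :
    smashAct n (extToSmash n w) f = ofExt w * f := by
  have : (smashAct n).comp (extToSmash n) = (Algebra.lmul ℚ (Poly n)).comp ofExt := by
    refine ExteriorAlgebra.hom_ext (LinearMap.pi_ext' fun i => LinearMap.ext_ring ?_)
    change smashAct n (extToSmash n (ExteriorAlgebra.ι ℚ (Pi.single i 1))) = _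
    rw [extToSmash_ι_single, smashAct_smashGen]
    rfl
  exact DFunLike.congr_fun (DFunLike.congr_fun this w) f

/-- The nilHecke factor acts first and keeps polynomials polynomial, after which `w` only fills the
exterior slot. This decoupling reduces faithfulness to that of the nilHecke factor. -/
theorem smashAct_smashMulLeft_tmul (w : Ext n) (h : NH n) (p : MvPolynomial (Fin n) ℚ) :
    smashAct n (smashMulLeft n (w ⊗ₜ h)) (ofPoly p)
      = (augmentation (nhAct n h (ofPoly p)) ⊗ₜ[ℚ] w : MvPolynomial (Fin n) ℚ ⊗[ℚ] Ext n) := by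
  rw [smashMulLeft_tmul, map_mul, Module.End.mul_apply, smashAct_extToSmash]
  change ofExt w * nhAct n h (ofPoly p) = _
  rw [nhAct_ofPoly, ← (ofPoly_comm_ofExt _ _).eq]
  refine (Algebra.TensorProduct.tmul_mul_tmul _ _ _ _).trans ?_
  rw [mul_one, one_mul, augmentation_ofPoly]

theorem eq_zero_of_smashAct_ofPoly {z : Ext n ⊗[ℚ] NH n}
    (hz : ∀ p, smashAct n (smashMulLeft n z) (ofPoly p) = 0) : z = 0 := by
  obtain ⟨b, rfl⟩ := TensorProduct.eq_repr_basis_left (Module.Basis.ofVectorSpace ℚ (Ext n)) z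
  have hb : ∀ i, b i = 0 := by
    intro i
    refine eq_zero_of_nhAct_ofPoly fun p => ?_
    have h := hz p
    rw [Finsupp.sum, map_sum, map_sum, LinearMap.sum_apply] at h
    have h' : ∑ i ∈ b.support, (augmentation (nhAct n (b i) (ofPoly p)) ⊗ₜ[ℚ]
        Module.Basis.ofVectorSpace ℚ (Ext n) i : MvPolynomial (Fin n) ℚ ⊗[ℚ] Ext n) = 0 := by
      refine Eq.trans (Finset.sum_congr rfl fun i _ => ?_) h
      exact (smashAct_smashMulLeft_tmul _ _ p).symm
    -- A basis of the exterior algebra remains independent over the polynomials, so each coefficient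
    -- `b i` separately kills `p`.
    have h0 := TensorProduct.sum_tmul_basis_right_eq_zero (Module.Basis.ofVectorSpace ℚ (Ext n))
      (b.mapRange (fun k => augmentation (nhAct n k (ofPoly p))) (by simp))
      (by
        rw [Finsupp.sum_mapRange_index (by simp)]
        exact h')
    rw [nhAct_ofPoly]
    have h1 := DFunLike.congr_fun h0 i
    rw [Finsupp.mapRange_apply] at h1
    rw [h1]
    exact map_zero _
  have : b = 0 := Finsupp.ext hb
  rw [this, Finsupp.sum_zero_index]

theorem smashAct_injective : Function.Injective (smashAct n) := by
  rw [injective_iff_map_eq_zero]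
  intro a ha
  obtain ⟨z, rfl⟩ := smashMulLeft_surjective a
  rw [eq_zero_of_smashAct_ofPoly (z := z) fun p => by rw [ha, LinearMap.zero_apply], map_zero]

theorem smashMulLeft_bijective : Function.Bijective (smashMulLeft n) := by
  refine ⟨?_, smashMulLeft_surjective⟩
  rw [injective_iff_map_eq_zero]
  intro z hz
  exact eq_zero_of_smashAct_ofPoly fun p => by rw [hz, map_zero, LinearMap.zero_apply]

end Smash

/-! ### The anti-involutions -/

section AntiInvolution

open MulOpposite

variable (n : ℕ)

/-- The nilHecke generators in the opposite algebra. -/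
noncomputable def nhGenOp : NHGen n → (NH n)ᵐᵒᵖ
  | .x i => op (nhX i)
  | .d i => op (nhD i)

/-- The relations are stable under reversing products: those for `∂_i x_i` and `∂_i x_{i+1}` are
exchanged up to sign, and the others are preserved individually. -/
theorem lift_nhGenOp_nhRel {a b : FreeAlgebra ℚ (NHGen n)} (h : NHRel n a b) :
    FreeAlgebra.lift ℚ (nhGenOp n) a = FreeAlgebra.lift ℚ (nhGenOp n) b := by
  have key := RingQuot.mkAlgHom_rel ℚ h
  cases h <;>
    simp only [fX, fD, map_mul, map_zero, map_one, map_neg, map_sub, map_add,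
      FreeAlgebra.lift_ι_apply, nhGenOp] at key ⊢ <;>
    simp only [← op_mul, ← op_sub, ← op_add, ← op_neg, ← op_one, ← op_zero] <;>
    refine congrArg op ?_
  case x_comm i j => exact key.symm
  case d_sq i => exact key
  case d_comm i j h => exact key.symm
  case d_braid i j h hj => simpa only [mul_assoc] using! key
  case d_braid_last i j h hj => simpa only [mul_assoc] using! key.symm
  case d_x_comm i j h h' => exact key.symm
  case d_x i j h =>
    have e := RingQuot.mkAlgHom_rel ℚ (NHRel.d_x_succ i j h)
    simp only [map_mul, map_one, map_neg, map_sub] at e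
    exact (neg_sub _ _).symm.trans ((congrArg Neg.neg e).trans (neg_neg _))
  case d_x_succ i j h =>
    have e := RingQuot.mkAlgHom_rel ℚ (NHRel.d_x i j h)
    simp only [map_mul, map_one, map_sub] at e
    exact (neg_sub _ _).symm.trans (congrArg Neg.neg e)
  case d_x_last i h => exact (add_comm _ _).trans key

/-- The anti-involution of the nilHecke algebra fixing the generators. -/
noncomputable def nhOp : NH n →ₐ[ℚ] (NH n)ᵐᵒᵖ :=
  RingQuot.liftAlgHom ℚ ⟨FreeAlgebra.lift ℚ (nhGenOp n), fun _ _ h => lift_nhGenOp_nhRel n h⟩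

theorem nhOp_mkAlgHom (a : FreeAlgebra ℚ (NHGen n)) :
    nhOp n (RingQuot.mkAlgHom ℚ (NHRel n) a) = FreeAlgebra.lift ℚ (nhGenOp n) a :=
  RingQuot.liftAlgHom_mkAlgHom_apply _ _ _ _

theorem nhOp_nhX (i : Fin n) : nhOp n (nhX i) = op (nhX i) := by
  rw [nhX, nhOp_mkAlgHom, FreeAlgebra.lift_ι_apply]; rfl

theorem nhOp_nhD (i : Fin n) : nhOp n (nhD i) = op (nhD i) := by
  rw [nhD, nhOp_mkAlgHom, FreeAlgebra.lift_ι_apply]; rfl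

theorem unop_nhOp_involutive : Function.Involutive fun h => unop (nhOp n h) := by
  have : (AlgHom.opComm (nhOp n)).comp (nhOp n) = AlgHom.id ℚ (NH n) := by
    refine RingQuot.ringQuot_ext' _ _ _ (FreeAlgebra.hom_ext (funext fun g => ?_))
    cases g with
    | x i =>
      change unop (nhOp n (unop (nhOp n (nhX i)))) = nhX i
      rw [nhOp_nhX, unop_op, nhOp_nhX, unop_op]
    | d i =>
      change unop (nhOp n (unop (nhOp n (nhD i)))) = nhD i
      rw [nhOp_nhD, unop_op, nhOp_nhD, unop_op]
  exact fun h => DFunLike.congr_fun this h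

theorem lift_op_smashGen_freeIncl (a : FreeAlgebra ℚ (NHGen n)) :
    FreeAlgebra.lift ℚ (fun g => op (smashGen n g)) (freeIncl n a)
      = AlgHom.op (nhToSmash n) (nhOp n (RingQuot.mkAlgHom ℚ (NHRel n) a)) := by
  have : (FreeAlgebra.lift ℚ (fun g => op (smashGen n g))).comp (freeIncl n)
      = (AlgHom.op (nhToSmash n)).comp ((nhOp n).comp (RingQuot.mkAlgHom ℚ (NHRel n))) := by
    refine FreeAlgebra.hom_ext (funext fun g => ?_)
    simp only [Function.comp_apply, AlgHom.comp_apply, nhOp_mkAlgHom, freeIncl,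
      FreeAlgebra.lift_ι_apply]
    cases g with
    | x i => exact congrArg op (nhToSmash_nhX i).symm
    | d i => exact congrArg op (nhToSmash_nhD i).symm
  exact DFunLike.congr_fun this a

theorem lift_op_smashGen_smashRel {a b : FreeAlgebra ℚ (ExtGen n)} (h : SmashRel n a b) :
    FreeAlgebra.lift ℚ (fun g => op (smashGen n g)) a
      = FreeAlgebra.lift ℚ (fun g => op (smashGen n g)) b := by
  cases h
  case nh a b h =>
    rw [lift_op_smashGen_freeIncl, lift_op_smashGen_freeIncl, RingQuot.mkAlgHom_rel ℚ h]
  all_goals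
    simp only [eX, eD, eOm, map_mul, map_zero, map_neg, map_sub, map_pow,
      FreeAlgebra.lift_ι_apply]
    simp only [← op_mul, ← op_pow, ← op_sub, ← op_neg, ← op_zero]
    refine congrArg op ?_
  case om_sq i => exact smashGen_om_sq i
  case om_anti i j => exact smashGen_om_mul n j i
  case x_om i j => exact (smashGen_x_mul_om i j).symm
  case d_om i j h => exact (smashGen_d_mul_om h).symm
  case d_om_shift i j h =>
    have e := smashGen_d_mul_shift h
    -- Reversal turns `x_j² ω_j` into `ω_j x_j²`, so the relation is preserved only because these
    -- commute.
    rw [((show Commute _ _ from smashGen_x_mul_om j j).pow_left 2).eq] at e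
    exact e.symm
  case d_om_last i j h => exact (smashGen_d_mul_om_last j h).symm

/-- The anti-involution of the smash product fixing the generators. -/
noncomputable def smashOp : Smash n →ₐ[ℚ] (Smash n)ᵐᵒᵖ :=
  RingQuot.liftAlgHom ℚ ⟨FreeAlgebra.lift ℚ fun g => op (smashGen n g),
    fun _ _ h => lift_op_smashGen_smashRel n h⟩

theorem smashOp_mkAlgHom (a : FreeAlgebra ℚ (ExtGen n)) :
    smashOp n (RingQuot.mkAlgHom ℚ (SmashRel n) a)
      = FreeAlgebra.lift ℚ (fun g => op (smashGen n g)) a :=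
  RingQuot.liftAlgHom_mkAlgHom_apply _ _ _ _

theorem smashOp_smashGen (g : ExtGen n) : smashOp n (smashGen n g) = op (smashGen n g) := by
  rw [smashGen, smashOp_mkAlgHom, FreeAlgebra.lift_ι_apply]; rfl

theorem unop_smashOp_involutive : Function.Involutive fun a => unop (smashOp n a) := by
  have : (AlgHom.opComm (smashOp n)).comp (smashOp n) = AlgHom.id ℚ (Smash n) := by
    refine RingQuot.ringQuot_ext' _ _ _ (FreeAlgebra.hom_ext (funext fun g => ?_))
    change unop (smashOp n (unop (smashOp n (smashGen n g)))) = smashGen n g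
    rw [smashOp_smashGen, unop_op, smashOp_smashGen, unop_op]
  exact fun h => DFunLike.congr_fun this h

theorem smashOp_nhToSmash (h : NH n) :
    unop (smashOp n (nhToSmash n h)) = nhToSmash n (unop (nhOp n h)) := by
  obtain ⟨a, rfl⟩ := RingQuot.mkAlgHom_surjective ℚ (NHRel n) h
  rw [nhToSmash_mkAlgHom, smashOp_mkAlgHom, lift_op_smashGen_freeIncl]
  rfl

theorem smashOp_extToSmash (w : Ext n) :
    unop (smashOp n (extToSmash n w)) = extToSmash n (CliffordAlgebra.reverse w) := by
  have : (smashOp n).comp (extToSmash n)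
      = (AlgHom.op (extToSmash n)).comp CliffordAlgebra.reverseOp := by
    refine ExteriorAlgebra.hom_ext (LinearMap.pi_ext' fun i => LinearMap.ext_ring ?_)
    change smashOp n (extToSmash n (ExteriorAlgebra.ι ℚ (Pi.single i 1)))
      = op (extToSmash n (unop (CliffordAlgebra.reverseOp (CliffordAlgebra.ι _ (Pi.single i 1)))))
    rw [CliffordAlgebra.reverseOp_ι, unop_op]
    change _ = op (extToSmash n (ExteriorAlgebra.ι ℚ (Pi.single i 1)))
    rw [extToSmash_ι_single, smashOp_smashGen]
  exact congrArg unop (DFunLike.congr_fun this w)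

/-- Under the anti-involution `h λ` becomes `λ' h'`, with `h'` and `λ'` the reversals of `h` and
`λ`. Up to bijections the map is thus `smashMulLeft`. -/
theorem smashMul_bijective : Function.Bijective (smashMul n) := by
  let opNH : NH n ≃ₗ[ℚ] NH n := LinearEquiv.ofInvolutive
    ((opLinearEquiv ℚ).symm.toLinearMap.comp (nhOp n).toLinearMap) (unop_nhOp_involutive n)
  let E : NH n ⊗[ℚ] Ext n ≃ₗ[ℚ] Ext n ⊗[ℚ] NH n :=
    (TensorProduct.congr opNH CliffordAlgebra.reverseEquiv).trans (TensorProduct.comm ℚ _ _)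
  have e : ∀ z, unop (smashOp n (smashMul n z)) = smashMulLeft n (E z) := by
    intro z
    induction z using TensorProduct.induction_on with
    | zero => simp only [map_zero, unop_zero]
    | tmul h w =>
      rw [smashMul_tmul, map_mul, unop_mul, smashOp_nhToSmash, smashOp_extToSmash]
      rfl
    | add x y hx hy => rw [map_add, map_add, unop_add, hx, hy, map_add, map_add]
  have hb : Function.Bijective ((fun a => unop (smashOp n a)) ∘ smashMul n) := by
    have : (fun a => unop (smashOp n a)) ∘ smashMul n = smashMulLeft n ∘ E := funext e
    rw [this]
    exact smashMulLeft_bijective.comp E.bijective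
  exact (Function.Bijective.of_comp_iff' (unop_smashOp_involutive n).bijective _).1 hb

end AntiInvolution

/-! ### The isomorphism -/

section Isomorphism

variable (n : ℕ)

theorem adjoin_range_smashGen : Algebra.adjoin ℚ (Set.range (smashGen n)) = ⊤ := by
  have : Subalgebra.toSubmodule (Algebra.adjoin ℚ (Set.range (smashGen n))) = ⊤ :=
    ringQuot_eq_top_of_left_mul_mem (one_mem (Algebra.adjoin ℚ (Set.range (smashGen n))))
      fun g a ha => (Algebra.adjoin ℚ (Set.range (smashGen n))).mul_mem
        (Algebra.subset_adjoin ⟨g, rfl⟩) ha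
  exact Algebra.toSubmodule_eq_top.1 this

theorem range_smashAct : (smashAct n).range = NHext n := by
  refine le_antisymm ?_ (Algebra.adjoin_le ?_)
  · rw [← Algebra.map_top, ← adjoin_range_smashGen, AlgHom.map_adjoin, Algebra.adjoin_le_iff]
    rintro _ ⟨_, ⟨g, rfl⟩, rfl⟩
    change smashAct n (smashGen n g) ∈ NHext n
    rw [smashAct_smashGen]
    cases g with
    | x i => exact Algebra.subset_adjoin (Or.inl ⟨px i, rfl⟩)
    | d i => exact Algebra.subset_adjoin (Or.inr ⟨i, rfl⟩)
    | om i => exact Algebra.subset_adjoin (Or.inl ⟨pom i, rfl⟩)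
  · rintro _ (⟨f, rfl⟩ | ⟨i, rfl⟩)
    · dsimp only
      induction f using poly_induction with
      | h p w =>
        refine ⟨nhToSmash n (polyToNH p) * extToSmash n w, LinearMap.ext fun f => ?_⟩
        change smashAct n (nhToSmash n (polyToNH p) * extToSmash n w) f = _
        rw [map_mul, Module.End.mul_apply, smashAct_extToSmash, LinearMap.mulLeft_apply, mul_assoc]
        exact nhAct_polyToNH p _
      | hadd a b ha hb =>
        have : LinearMap.mulLeft ℚ (a + b) = LinearMap.mulLeft ℚ a + LinearMap.mulLeft ℚ b :=
          LinearMap.ext fun f => add_mul a b f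
        rw [this]
        exact add_mem ha hb
    · exact ⟨smashGen n (.d i), smashAct_smashGen n _⟩

/-- The isomorphism of the smash product with the extended nilHecke algebra. -/
noncomputable def smashEquiv : Smash n ≃ₐ[ℚ] NHext n :=
  (AlgEquiv.ofInjective (smashAct n) smashAct_injective).trans
    (Subalgebra.equivOfEq _ _ (range_smashAct n))

theorem smashEquiv_smashGen (g : ExtGen n) : smashEquiv n (smashGen n g) = opGen n g := by
  refine Subtype.ext ?_
  change smashAct n (smashGen n g) = opGen n g
  rw [smashAct_smashGen]
  cases g <;> rfl

end Isomorphism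

/-! ### The gradings -/

section Grading

variable {n : ℕ} {A : Type} [Ring A] [Algebra ℚ A]

/-- The sign `(-1)^p`. -/
def paritySign (p : ZMod 2) : ℚ := if p = 0 then 1 else -1

theorem paritySign_add (p q : ZMod 2) : paritySign (p + q) = paritySign p * paritySign q := by
  fin_cases p <;> fin_cases q <;> simp [paritySign] <;> decide

theorem word_mem_parityPart (g : ExtGen n → A) (w : List (ExtGen n)) :
    (w.map g).prod ∈ parityPart g (w.map parity).sum :=
  Submodule.subset_span ⟨w, rfl, rfl⟩

theorem gradedMonoid_parityPart (g : ExtGen n → A) : SetLike.GradedMonoid (parityPart g) where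
  one_mem := word_mem_parityPart g []
  mul_mem p q a b ha hb := by
    induction ha using Submodule.span_induction with
    | mem a ha =>
      obtain ⟨v, rfl, rfl⟩ := ha
      induction hb using Submodule.span_induction with
      | mem b hb =>
        obtain ⟨w, rfl, rfl⟩ := hb
        simpa using word_mem_parityPart g (v ++ w)
      | zero => rw [mul_zero]; exact Submodule.zero_mem _
      | add x y _ _ hx hy => rw [mul_add]; exact Submodule.add_mem _ hx hy
      | smul r x _ hx => rw [mul_smul_comm]; exact Submodule.smul_mem _ _ hx
    | zero => rw [zero_mul]; exact Submodule.zero_mem _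
    | add x y _ _ hx hy => rw [add_mul]; exact Submodule.add_mem _ hx hy
    | smul r x _ hx => rw [smul_mul_assoc]; exact Submodule.smul_mem _ _ hx

theorem sup_parityPart {g : ExtGen n → A} (hg : Algebra.adjoin ℚ (Set.range g) = ⊤) :
    parityPart g 0 ⊔ parityPart g 1 = ⊤ := by
  rw [← top_le_iff, ← Algebra.top_toSubmodule, ← hg, Algebra.adjoin_eq_span, Submodule.span_le]
  intro a ha
  have : ∃ w : List (ExtGen n), (w.map g).prod = a := by
    induction ha using Submonoid.closure_induction with
    | mem x hx =>
      obtain ⟨i, rfl⟩ := hx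
      exact ⟨[i], by simp⟩
    | one => exact ⟨[], rfl⟩
    | mul x y _ _ hx hy =>
      obtain ⟨v, rfl⟩ := hx
      obtain ⟨w, rfl⟩ := hy
      exact ⟨v ++ w, by simp⟩
  obtain ⟨w, rfl⟩ := this
  have h2 : ∀ p : ZMod 2, p = 0 ∨ p = 1 := by decide
  have hw := word_mem_parityPart g w
  obtain h | h := h2 (w.map parity).sum
  · exact Submodule.mem_sup_left (h ▸ hw)
  · exact Submodule.mem_sup_right (h ▸ hw)

theorem apply_of_mem_parityPart {g : ExtGen n → A} {ε : A →ₐ[ℚ] A}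
    (hε : ∀ x, ε (g x) = paritySign (parity x) • g x) {p : ZMod 2} {a : A}
    (ha : a ∈ parityPart g p) : ε a = paritySign p • a := by
  induction ha using Submodule.span_induction with
  | mem a ha =>
    obtain ⟨w, rfl, rfl⟩ := ha
    induction w with
    | nil => simp [paritySign]
    | cons x w ih =>
      simp only [List.map_cons, List.prod_cons, List.sum_cons, map_mul, hε, ih, paritySign_add,
        smul_mul_smul_comm]
  | zero => rw [map_zero, smul_zero]
  | add x y _ _ hx hy => rw [map_add, smul_add, hx, hy]
  | smul r x _ hx => rw [map_smul, hx, smul_comm]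

/-- An algebra with generators of prescribed parities is a superalgebra as soon as it has an
automorphism acting on the generators by the corresponding signs. -/
theorem nonempty_gradedAlgebra_parityPart {g : ExtGen n → A}
    (hg : Algebra.adjoin ℚ (Set.range g) = ⊤) {ε : A →ₐ[ℚ] A}
    (hε : ∀ x, ε (g x) = paritySign (parity x) • g x) :
    Nonempty (GradedAlgebra (parityPart g)) := by
  -- An element of both parts is fixed and negated by `ε`, hence is zero because `2` is invertible.
  have hc : IsCompl (parityPart g 0) (parityPart g 1) := by
    refine ⟨Submodule.disjoint_def.2 fun a h0 h1 => ?_, codisjoint_iff.2 (sup_parityPart hg)⟩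
    have e0 := apply_of_mem_parityPart hε h0
    have e1 := apply_of_mem_parityPart hε h1
    rw [e0] at e1
    simp only [paritySign, if_true, one_ne_zero, if_false, one_smul, neg_smul] at e1
    have h2 : (2 : ℚ) • a = 0 := by
      rw [two_smul]; nth_rewrite 1 [e1]; exact neg_add_cancel a
    exact (smul_eq_zero.1 h2).resolve_left two_ne_zero
  have huniv : (Set.univ : Set (ZMod 2)) = {0, 1} := by
    ext p
    have : p = 0 ∨ p = 1 := by revert p; decide
    simpa using this
  have hi : DirectSum.IsInternal (parityPart g) :=
    (DirectSum.isInternal_submodule_iff_isCompl _ zero_ne_one huniv).2 hc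
  exact ⟨{ gradedMonoid_parityPart g, hi.chooseDecomposition with }⟩

theorem map_parityPart {B : Type} [Ring B] [Algebra ℚ B] (g : ExtGen n → A) (φ : A →ₐ[ℚ] B)
    (p : ZMod 2) : (parityPart g p).map φ.toLinearMap = parityPart (φ ∘ g) p := by
  rw [parityPart, parityPart, Submodule.map_span]
  congr 1
  ext b
  constructor
  · rintro ⟨_, ⟨w, hw, rfl⟩, rfl⟩
    exact ⟨w, hw, by simp [map_list_prod]⟩
  · rintro ⟨w, hw, rfl⟩
    exact ⟨_, ⟨w, hw, rfl⟩, by simp [map_list_prod]⟩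

variable (n) in
-- Each defining relation is homogeneous in the number of `ω`'s modulo `2`, so negating all `ω_i`
-- preserves it.
theorem lift_sign_smashRel {a b : FreeAlgebra ℚ (ExtGen n)} (h : SmashRel n a b) :
    FreeAlgebra.lift ℚ (fun g => paritySign (parity g) • smashGen n g) a
      = FreeAlgebra.lift ℚ (fun g => paritySign (parity g) • smashGen n g) b := by
  have key := smash_mkAlgHom_eq h
  cases h
  case nh a b h =>
    have e : (FreeAlgebra.lift ℚ fun g => paritySign (parity g) • smashGen n g).comp (freeIncl n)
        = (RingQuot.mkAlgHom ℚ (SmashRel n)).comp (freeIncl n) := by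
      refine FreeAlgebra.hom_ext (funext fun g => ?_)
      simp only [Function.comp_apply, AlgHom.comp_apply, freeIncl, FreeAlgebra.lift_ι_apply]
      cases g <;> exact one_smul ℚ _
    exact (DFunLike.congr_fun e a).trans (key.trans (DFunLike.congr_fun e b).symm)
  all_goals
    simp only [eX, eD, eOm, map_mul, map_zero, map_neg, map_sub, map_pow,
      FreeAlgebra.lift_ι_apply, parity, paritySign, if_true, one_ne_zero, if_false, one_smul]
  case om_sq i => exact (neg_mul_neg _ _).trans (smashGen_om_sq i)
  case om_anti i j =>
    exact (neg_mul_neg _ _).trans ((smashGen_om_mul n i j).trans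
      (congrArg Neg.neg (neg_mul_neg _ _).symm))
  case x_om i j =>
    exact (mul_neg _ _).trans ((congrArg Neg.neg (smashGen_x_mul_om i j)).trans (neg_mul _ _).symm)
  case d_om i j h =>
    exact (mul_neg _ _).trans ((congrArg Neg.neg (smashGen_d_mul_om h)).trans (neg_mul _ _).symm)
  case d_om_shift i j h =>
    have g : ∀ {R : Type} [Ring R] {d a b y : R}, d * (a - y * b) = (a - y * b) * d →
        d * (-a - y * -b) = (-a - y * -b) * d := by
      intro R _ d a b y h
      have e : -a - y * -b = -(a - y * b) := by noncomm_ring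
      rw [e, mul_neg, h, neg_mul]
    exact g (smashGen_d_mul_shift h)
  case d_om_last i j h =>
    exact (mul_neg _ _).trans
      ((congrArg Neg.neg (smashGen_d_mul_om_last j h)).trans (neg_mul _ _).symm)

variable (n) in
/-- The parity automorphism of the smash product. -/
noncomputable def smashSign : Smash n →ₐ[ℚ] Smash n :=
  RingQuot.liftAlgHom ℚ ⟨FreeAlgebra.lift ℚ fun g => paritySign (parity g) • smashGen n g,
    fun _ _ h => lift_sign_smashRel n h⟩

theorem smashSign_smashGen (g : ExtGen n) :
    smashSign n (smashGen n g) = paritySign (parity g) • smashGen n g :=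
  (RingQuot.liftAlgHom_mkAlgHom_apply _ _ _ _).trans (FreeAlgebra.lift_ι_apply _ _)

end Grading

end ExtNilHecke

theorem proposition1 (n : ℕ) :
    -- both sides are superalgebras, with the `ω_i` odd and the `x_i`, `∂_i` even
    Nonempty (GradedAlgebra (ExtNilHecke.parityPart (ExtNilHecke.smashGen n))) ∧
    Nonempty (GradedAlgebra (ExtNilHecke.parityPart (ExtNilHecke.opGen n))) ∧
    -- the right-hand side is, as a vector space, the tensor product of its two factors
    Function.Bijective (ExtNilHecke.smashMul n) ∧
    -- the isomorphism of superalgebras, matching the generators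
    ∃ φ : ExtNilHecke.Smash n ≃ₐ[ℚ] ExtNilHecke.NHext n,
      (∀ g : ExtNilHecke.ExtGen n, φ (ExtNilHecke.smashGen n g) = ExtNilHecke.opGen n g) ∧
      ∀ p : ZMod 2,
        (ExtNilHecke.parityPart (ExtNilHecke.smashGen n) p).map φ.toLinearMap =
          ExtNilHecke.parityPart (ExtNilHecke.opGen n) p := by
  have hφ : (ExtNilHecke.smashEquiv n : _ →ₐ[ℚ] _) ∘ ExtNilHecke.smashGen n
      = ExtNilHecke.opGen n := funext (ExtNilHecke.smashEquiv_smashGen n)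
  refine ⟨ExtNilHecke.nonempty_gradedAlgebra_parityPart (ExtNilHecke.adjoin_range_smashGen n)
    ExtNilHecke.smashSign_smashGen, ?_, ExtNilHecke.smashMul_bijective n,
    ExtNilHecke.smashEquiv n, ExtNilHecke.smashEquiv_smashGen n, fun p => ?_⟩
  · refine ExtNilHecke.nonempty_gradedAlgebra_parityPart
      -- On operators the parity automorphism is the one of the smash product, transported along the
      -- isomorphism.
      (ε := ((ExtNilHecke.smashEquiv n : _ →ₐ[ℚ] _).comp (ExtNilHecke.smashSign n)).comp
        ((ExtNilHecke.smashEquiv n).symm : _ →ₐ[ℚ] _)) ?_ fun g => ?_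
    · rw [← hφ, Set.range_comp, ← AlgHom.map_adjoin, ExtNilHecke.adjoin_range_smashGen,
        Algebra.map_top]
      exact (AlgHom.range_eq_top
        (ExtNilHecke.smashEquiv n : ExtNilHecke.Smash n →ₐ[ℚ] ExtNilHecke.NHext n)).2
        (ExtNilHecke.smashEquiv n).surjective
    · have e : (ExtNilHecke.smashEquiv n).symm (ExtNilHecke.opGen n g)
          = ExtNilHecke.smashGen n g := by
        rw [← ExtNilHecke.smashEquiv_smashGen, AlgEquiv.symm_apply_apply]
      change ExtNilHecke.smashEquiv n (ExtNilHecke.smashSign n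
        ((ExtNilHecke.smashEquiv n).symm (ExtNilHecke.opGen n g))) = _
      rw [e, ExtNilHecke.smashSign_smashGen, map_smul, ExtNilHecke.smashEquiv_smashGen]
  · rw [← hφ]
    exact ExtNilHecke.map_parityPart (B := ExtNilHecke.NHext n) (ExtNilHecke.smashGen n)
      (ExtNilHecke.smashEquiv n : ExtNilHecke.Smash n →ₐ[ℚ] ExtNilHecke.NHext n) p
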